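/- Let $M$ be a smooth $m$-manifold with a foliation $\mathcal F$ of codimension $q$, defined by a cocycle $\{U_i,f_i,\gamma_{ij}\}$ modelled on a smooth $q$-manifold $N$: the $U_i$ form an open covering of $M$, the $f_i:U_i\to N$ are smooth submersions with connected fibres, and the $\gamma_{ij}$ are local diffeomorphisms of $N$ with $f_i=\gamma_{ij}\circ f_j$ on $U_i\cap U_j$. Let $g$ and $g_0$ be smooth Riemannian metrics on $M$ and $N$ for which $\mathcal F$ is Riemannian, i.e. the $f_i$ are Riemannian submersions and the $\gamma_{ij}$ are local isometries. Let $N(M,\mathcal F)=TM/T\mathcal F$ be the normal bundle, identified with $T\mathcal F^{\perp}$ by means of $g$ and carrying the induced metric. Let $\nabla$ be its foliated Levi-Civita connection (the pullback under the $f_i$ of the Levi-Civita connection of $(N,g_0)$), let $R$ and $\mathrm{Ric}$ be its (transverse) curvature and Ricci tensors, with the conventions $R(X,Y)=[\nabla_X,\nabla_Y]-\nabla_{[X,Y]}$, $R(X,Y,Z,W)=\langle R(X,Y)W,Z\rangle$ and $\mathrm{Ric}(X,Y)=\sum_i R(e_i,X,e_i,Y)$ for an orthonormal frame $(e_i)$.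 A normal tensor field of rank $p$ is a smooth section $U$ of $\bigotimes^p N(M,\mathcal F)^*$ (not necessarily constant along the leaves). Its basic Laplacian is the normal tensor field of rank $p$ given, in a local orthonormal frame $(e_A)_{A=1,\dots,q}$ of the normal bundle and with $R_{ab,cd}=R(e_a,e_b,e_c,e_d)$, by $$(\Delta_b U)_{\alpha_1\dots\alpha_p}=-\nabla^i\nabla_i U_{\alpha_1\dots\alpha_p}+\sum_{j}\sum_{A}\mathrm{Ric}_{\alpha_jA}\,U_{\alpha_1\dots A\dots\alpha_p}-\sum_{j\ne k}\sum_{A,B}R_{\alpha_jA,\alpha_kB}\,U_{\alpha_1\dots A\dots B\dots\alpha_p},$$ where $A$ stands in the $j$-th and $B$ in the $k$-th place, the last sum is over ordered pairs $(j,k)$, and $\nabla^i\nabla_i=\sum_{i=1}^q(\nabla_{e_i}\nabla_{e_i}-\nabla_{\nabla_{e_i}e_i})$. **Theorem.** Let $T$ be a normal tensor field of rank $p\ge 0$ with $\nabla T=0$ (that is, $\nabla_vT=0$ for every $v\in TM$). Then for every normal tensor field $U$ of any rank $r\ge 0$, $$\Delta_b(T\otimes U)=T\otimes\Delta_b U .$$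 -/

import Mathlib

open Set Bundle
open scoped Manifold ContDiff Topology

noncomputable section

/-- The coordinate space `ℝ^q`. -/
abbrev Coord (q : ℕ) : Type := EuclideanSpace ℝ (Fin q)

/-- A smooth Riemannian metric on the tangent bundle of an `n`-manifold `X`. -/
abbrev TangentMetric (n : ℕ) (X : Type*) [TopologicalSpace X] [ChartedSpace (Coord n) X]
    [IsManifold (𝓡 n) ∞ X] :=
  ContMDiffRiemannianMetric (𝓡 n) ∞ (Coord n) (fun x : X => TangentSpace (𝓡 n) x)

/-! ### Levi-Civita calculus of a Riemannian `q`-manifold in a chart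

`y₀ : N` selects the chart `extChartAt (𝓡 q) y₀`; `z` is a point of its target in `ℝ^q`. -/

section Riemannian

variable {q : ℕ} {N : Type*} [TopologicalSpace N] [ChartedSpace (Coord q) N]
  [IsManifold (𝓡 q) ∞ N]

/-- The partial derivative `∂_a u (z)`. -/
def partialDeriv (a : Fin q) (u : Coord q → ℝ) (z : Coord q) : ℝ :=
  fderiv ℝ u z (EuclideanSpace.single a 1)

/-- The metric coefficients `g_{ab} = g(∂_a, ∂_b)`. -/
def metricCoeff (g : TangentMetric q N) (y₀ : N) (z : Coord q) : Matrix (Fin q) (Fin q) ℝ :=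
  Matrix.of fun a b =>
    g.inner ((extChartAt (𝓡 q) y₀).symm z)
      (mfderiv 𝓘(ℝ, Coord q) (𝓡 q) (extChartAt (𝓡 q) y₀).symm z (EuclideanSpace.single a 1))
      (mfderiv 𝓘(ℝ, Coord q) (𝓡 q) (extChartAt (𝓡 q) y₀).symm z (EuclideanSpace.single b 1))

/-- The inverse matrix `g^{ab}` of the metric coefficients. -/
def metricInv (g : TangentMetric q N) (y₀ : N) (z : Coord q) : Matrix (Fin q) (Fin q) ℝ :=
  (metricCoeff g y₀ z)⁻¹

/-- The Christoffel symbols of the Levi-Civita connection: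
`christoffel g y₀ a b d z` is `Γ^d_{ab}`, where `∇_{∂_a} ∂_b = ∑ d, Γ^d_{ab} ∂_d`. -/
def christoffel (g : TangentMetric q N) (y₀ : N) (a b d : Fin q) (z : Coord q) : ℝ :=
  (1 / 2) * ∑ k, metricInv g y₀ z d k *
    (partialDeriv a (fun w => metricCoeff g y₀ w b k) z
      + partialDeriv b (fun w => metricCoeff g y₀ w a k) z
      - partialDeriv k (fun w => metricCoeff g y₀ w a b) z)

/-- The coefficients of the curvature operator
`R(X, Y) = ∇_X ∇_Y - ∇_Y ∇_X - ∇_{[X, Y]}`: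
`R(∂_a, ∂_b) ∂_c = ∑ d, curvCoeff g y₀ a b c d • ∂_d`. -/
def curvCoeff (g : TangentMetric q N) (y₀ : N) (a b c d : Fin q) (z : Coord q) : ℝ :=
  partialDeriv a (christoffel g y₀ b c d) z - partialDeriv b (christoffel g y₀ a c d) z
    + ∑ e, (christoffel g y₀ a e d z * christoffel g y₀ b c e z
      - christoffel g y₀ b e d z * christoffel g y₀ a c e z)

/-- The Riemann tensor `R_{ab,cd} = g(R(∂_a, ∂_b) ∂_d, ∂_c)`. -/
def riemann (g : TangentMetric q N) (y₀ : N) (a b c d : Fin q) (z : Coord q) : ℝ :=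
  ∑ e, curvCoeff g y₀ a b d e z * metricCoeff g y₀ z e c

/-- The Ricci tensor `Ric_{ab}`, the trace of `Z ↦ R(Z, ∂_a) ∂_b`. -/
def ricci (g : TangentMetric q N) (y₀ : N) (a b : Fin q) (z : Coord q) : ℝ :=
  ∑ c, curvCoeff g y₀ c a b c z

end Riemannian

/-! ### Foliations -/

/-- The derivative `v(u)` of the function `u` in the direction `v ∈ T_x M`. -/
def dirDeriv {m : ℕ} {M : Type*} [TopologicalSpace M] [ChartedSpace (Coord m) M] (u : M → ℝ)
    (x : M) (v : TangentSpace (𝓡 m) x) : ℝ :=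
  mfderiv (𝓡 m) 𝓘(ℝ, ℝ) u x v

/-- A foliation of codimension `q` of the `m`-manifold `M`, given by a cocycle
`{U_i, f_i, γ_ij}` modelled on the `q`-manifold `N`: the `U_i` are an open covering of `M`, the
`f_i : U_i → N` are smooth submersions with connected fibres, and the `γ_ij` are local
diffeomorphisms of `N` with `f_i = γ_ij ∘ f_j` on `U_i ∩ U_j`. -/
structure Foliation (m q : ℕ) (M N ι : Type*)
    [TopologicalSpace M] [ChartedSpace (Coord m) M]
    [TopologicalSpace N] [ChartedSpace (Coord q) N] where
  U : ι → Set M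
  isOpen_U : ∀ i, IsOpen (U i)
  exists_mem : ∀ x, ∃ i, x ∈ U i
  f : ι → M → N
  contMDiffOn_f : ∀ i, ContMDiffOn (𝓡 m) (𝓡 q) ∞ (f i) (U i)
  submersion : ∀ i, ∀ x ∈ U i, Function.Surjective (mfderiv (𝓡 m) (𝓡 q) (f i) x)
  isPreconnected_fibre : ∀ i y, IsPreconnected (U i ∩ f i ⁻¹' {y})
  γ : ι → ι → OpenPartialHomeomorph N N
  contMDiffOn_γ : ∀ i j, ContMDiffOn (𝓡 q) (𝓡 q) ∞ (γ i j) (γ i j).source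
  contMDiffOn_γ_symm : ∀ i j, ContMDiffOn (𝓡 q) (𝓡 q) ∞ (γ i j).symm (γ i j).target
  mem_source : ∀ i j, ∀ x ∈ U i ∩ U j, f j x ∈ (γ i j).source
  f_eq : ∀ i j, ∀ x ∈ U i ∩ U j, f i x = γ i j (f j x)

namespace Foliation

variable {m q : ℕ} {M N ι : Type*}
  [TopologicalSpace M] [ChartedSpace (Coord m) M]
  [TopologicalSpace N] [ChartedSpace (Coord q) N]

/-- The tangent space `T_x F` of the leaf through `x`: the common kernel of the differentials at
`x` of the local submersions defined at `x` (all of these kernels coincide). -/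
def leafTangent (F : Foliation m q M N ι) (x : M) : Submodule ℝ (TangentSpace (𝓡 m) x) :=
  ⨅ (i : ι) (_ : x ∈ F.U i), LinearMap.ker (mfderiv (𝓡 m) (𝓡 q) (F.f i) x).toLinearMap

/-- The fibre at `x` of the normal bundle `TM / TF`. -/
abbrev Normal (F : Foliation m q M N ι) (x : M) : Type :=
  TangentSpace (𝓡 m) x ⧸ F.leafTangent x

lemma leafTangent_le (F : Foliation m q M N ι) {x : M} {i : ι} (hx : x ∈ F.U i) :
    F.leafTangent x ≤ LinearMap.ker (mfderiv (𝓡 m) (𝓡 q) (F.f i) x).toLinearMap :=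
  iInf₂_le i hx

/-- The identification `Normal x → T_{f_i(x)} N` induced by the differential of `f_i`. -/
def normalDeriv (F : Foliation m q M N ι) {x : M} {i : ι} (hx : x ∈ F.U i) :
    F.Normal x →ₗ[ℝ] TangentSpace (𝓡 q) (F.f i x) :=
  (F.leafTangent x).liftQ (mfderiv (𝓡 m) (𝓡 q) (F.f i) x).toLinearMap (F.leafTangent_le hx)

/-- A (not necessarily smooth) normal tensor field of rank `p`: a section of the `p`-th tensor
power of the dual of the normal bundle. -/
abbrev NormalTensor (F : Foliation m q M N ι) (p : ℕ) : Type _ :=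
  ∀ x : M, MultilinearMap ℝ (fun _ : Fin p => F.Normal x) ℝ

/-- A normal tensor field is smooth if its values on (the classes of) arbitrary local smooth
vector fields are smooth. -/
def NormalTensor.IsSmooth {F : Foliation m q M N ι} [IsManifold (𝓡 m) ∞ M] {p : ℕ}
    (T : F.NormalTensor p) : Prop :=
  ∀ (O : Set M), IsOpen O → ∀ X : Fin p → ∀ x : M, TangentSpace (𝓡 m) x,
    (∀ j, ContMDiffOn (𝓡 m) (𝓡 m).tangent ∞
      (fun x => (⟨x, X j x⟩ : TangentBundle (𝓡 m) M)) O) →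
    ContMDiffOn (𝓡 m) 𝓘(ℝ, ℝ) ∞
      (fun x => T x fun j => (F.leafTangent x).mkQ (X j x)) O

/-- The tensor product `(T ⊗ U)(w) = T(w_1, …, w_p) U(w_{p+1}, …, w_{p+r})`. -/
def NormalTensor.tensor {F : Foliation m q M N ι} {p r : ℕ}
    (T : F.NormalTensor p) (U : F.NormalTensor r) : F.NormalTensor (p + r) := fun x =>
  ((LinearMap.mul' ℝ ℝ).compMultilinearMap ((T x).domCoprod (U x))).domDomCongr finSumFinEquiv

/-- The transverse coordinates `f_i` followed by the chart of `N` at `y₀`. -/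
def coord (F : Foliation m q M N ι) (i : ι) (y₀ : N) (x : M) : Coord q :=
  extChartAt (𝓡 q) y₀ (F.f i x)

/-- The `a`-th transverse coordinate of a vector `v ∈ T_x M`, i.e. `v^a` in `[v] = ∑ a, v^a [∂_a]`.
-/
def coordDeriv (F : Foliation m q M N ι) (i : ι) (y₀ : N) (a : Fin q) (x : M)
    (v : TangentSpace (𝓡 m) x) : ℝ :=
  (EuclideanSpace.proj a : Coord q →L[ℝ] ℝ)
    (mfderiv (𝓡 m) 𝓘(ℝ, Coord q) (F.coord i y₀) x v)

/-- The open set on which the transverse coordinates `F.coord i y₀` are defined. -/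
def coordDomain (F : Foliation m q M N ι) (i : ι) (y₀ : N) : Set M :=
  F.U i ∩ F.f i ⁻¹' (extChartAt (𝓡 q) y₀).source

/-- The components of a normal vector in the transverse coordinates: `w = ∑ a, w^a ∂_a`. -/
def normalCoord (F : Foliation m q M N ι) {i : ι} (y₀ : N) {x : M} (hx : x ∈ F.U i)
    (a : Fin q) : F.Normal x →ₗ[ℝ] ℝ :=
  (EuclideanSpace.proj a : Coord q →L[ℝ] ℝ).toLinearMap ∘ₗ
    (mfderiv (𝓡 q) 𝓘(ℝ, Coord q) (extChartAt (𝓡 q) y₀) (F.f i x)).toLinearMap ∘ₗ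
      F.normalDeriv hx

variable [IsManifold (𝓡 m) ∞ M] [IsManifold (𝓡 q) ∞ N]

/-- The foliation is Riemannian for the metrics `g` on `M` and `g₀` on `N` (that is, `g` is
bundle-like with transverse metric `g₀`): the `f_i` are Riemannian submersions and the `γ_ij` are
local isometries. -/
structure IsRiemannian (F : Foliation m q M N ι) (g : TangentMetric m M)
    (g₀ : TangentMetric q N) : Prop where
  submersion : ∀ i, ∀ x ∈ F.U i, ∀ v w : TangentSpace (𝓡 m) x,
    (∀ u ∈ F.leafTangent x, g.inner x v u = 0) → (∀ u ∈ F.leafTangent x, g.inner x w u = 0) →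
    g₀.inner (F.f i x) (mfderiv (𝓡 m) (𝓡 q) (F.f i) x v) (mfderiv (𝓡 m) (𝓡 q) (F.f i) x w)
      = g.inner x v w
  isometry : ∀ i j, ∀ y ∈ (F.γ i j).source, ∀ v w : TangentSpace (𝓡 q) y,
    g₀.inner (F.γ i j y) (mfderiv (𝓡 q) (𝓡 q) (F.γ i j) y v) (mfderiv (𝓡 q) (𝓡 q) (F.γ i j) y w)
      = g₀.inner y v w

/-- The local frame `e_a` of the orthogonal complement of `TF`: `e_a(x)` is the unique vector
orthogonal to `T_x F` that projects to the coordinate vector `∂_a`. -/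
def horizFrame (F : Foliation m q M N ι) (g : TangentMetric m M) (i : ι) (y₀ : N) (a : Fin q)
    (x : M) : TangentSpace (𝓡 m) x :=
  Classical.epsilon fun v : TangentSpace (𝓡 m) x =>
    (∀ u ∈ F.leafTangent x, g.inner x v u = 0) ∧
      mfderiv (𝓡 m) 𝓘(ℝ, Coord q) (F.coord i y₀) x v = EuclideanSpace.single a (1 : ℝ)

/-- The component `T_{c_1 … c_p} = T([e_{c_1}], …, [e_{c_p}])`. -/
def comp (F : Foliation m q M N ι) (g : TangentMetric m M) (i : ι) (y₀ : N) {p : ℕ}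
    (T : F.NormalTensor p) (c : Fin p → Fin q) (x : M) : ℝ :=
  T x fun j => (F.leafTangent x).mkQ (F.horizFrame g i y₀ (c j) x)

/-- The component `(∇_v T)_{c_1 … c_p}` at `x`, `v ∈ T_x M`, of the covariant derivative of `T`
for the foliated Levi-Civita connection of the normal bundle, i.e. the pullback by `f_i` of the
Levi-Civita connection of `(N, g₀)`: `∇_v [e_b] = ∑ a d, v^a Γ^d_{ab} [e_d]`, where `v^a` are the
components of the class of `v`. -/
def covDeriv (F : Foliation m q M N ι) (g : TangentMetric m M) (g₀ : TangentMetric q N) (i : ι)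
    (y₀ : N) {p : ℕ} (T : F.NormalTensor p) (c : Fin p → Fin q) (x : M)
    (v : TangentSpace (𝓡 m) x) : ℝ :=
  dirDeriv (F.comp g i y₀ T c) x v
    - ∑ j, ∑ a, ∑ d,
      F.coordDeriv i y₀ a x v
        * christoffel g₀ y₀ a (c j) d (F.coord i y₀ x)
        * F.comp g i y₀ T (Function.update c j d) x

/-- The component `(∇_{e_a} ∇_{e_b} T - ∇_{∇_{e_a} e_b} T)_{c_1 … c_p}` at `x` of the second
covariant derivative of `T`. -/
def covDeriv₂ (F : Foliation m q M N ι) (g : TangentMetric m M) (g₀ : TangentMetric q N) (i : ι)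
    (y₀ : N) {p : ℕ} (T : F.NormalTensor p) (a b : Fin q) (c : Fin p → Fin q) (x : M) : ℝ :=
  dirDeriv (fun z => F.covDeriv g g₀ i y₀ T c z (F.horizFrame g i y₀ b z)) x
      (F.horizFrame g i y₀ a x)
    - ∑ j, ∑ d, christoffel g₀ y₀ a (c j) d (F.coord i y₀ x)
        * F.covDeriv g g₀ i y₀ T (Function.update c j d) x (F.horizFrame g i y₀ b x)
    - ∑ d, christoffel g₀ y₀ a b d (F.coord i y₀ x)
        * F.covDeriv g g₀ i y₀ T c x (F.horizFrame g i y₀ d x)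

/-- The covariant derivative of the normal tensor field `T` vanishes (in all directions of `TM`).
-/
def IsParallel (F : Foliation m q M N ι) (g : TangentMetric m M) (g₀ : TangentMetric q N)
    {p : ℕ} (T : F.NormalTensor p) : Prop :=
  ∀ (i : ι) (y₀ : N), ∀ x ∈ F.coordDomain i y₀, ∀ (v : TangentSpace (𝓡 m) x)
    (c : Fin p → Fin q), F.covDeriv g g₀ i y₀ T c x v = 0

/-- The component of the basic Laplacian of the normal tensor field `T` in transverse coordinates,
`- ∇^a ∇_a T_{c_1 … c_p} + ∑ j, Ric_{c_j}^A T_{… A …}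
  - ∑ j ≠ k, R_{c_j}^A_{c_k}^B T_{… A … B …}`
with `A` in the `j`-th place and `B` in the `k`-th place. -/
def laplacianComp (F : Foliation m q M N ι) (g : TangentMetric m M) (g₀ : TangentMetric q N)
    (i : ι) (y₀ : N) {p : ℕ} (T : F.NormalTensor p) (c : Fin p → Fin q) (x : M) : ℝ :=
  - ∑ a, ∑ b, metricInv g₀ y₀ (F.coord i y₀ x) a b * F.covDeriv₂ g g₀ i y₀ T a b c x
    + ∑ j, ∑ A, ∑ A', ricci g₀ y₀ (c j) A (F.coord i y₀ x)
        * metricInv g₀ y₀ (F.coord i y₀ x) A A'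
        * F.comp g i y₀ T (Function.update c j A') x
    - ∑ j, ∑ k ∈ Finset.univ.erase j, ∑ A, ∑ A', ∑ B, ∑ B',
        riemann g₀ y₀ (c j) A (c k) B (F.coord i y₀ x)
        * metricInv g₀ y₀ (F.coord i y₀ x) A A' * metricInv g₀ y₀ (F.coord i y₀ x) B B'
        * F.comp g i y₀ T (Function.update (Function.update c j A') k B') x

/-- The normal tensor at `x ∈ U_i` whose components in the transverse coordinates `F.coord i y₀`
are those of the basic Laplacian of `T`. -/
def laplacianIn (F : Foliation m q M N ι) (g : TangentMetric m M) (g₀ : TangentMetric q N)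
    {i : ι} (y₀ : N) {p : ℕ} (T : F.NormalTensor p) {x : M} (hx : x ∈ F.U i) :
    MultilinearMap ℝ (fun _ : Fin p => F.Normal x) ℝ :=
  ∑ c : Fin p → Fin q, F.laplacianComp g g₀ i y₀ T c x •
    (MultilinearMap.mkPiAlgebra ℝ (Fin p) ℝ).compLinearMap
      fun j => F.normalCoord y₀ hx (c j)

/-- The basic Laplacian `Δ_b T` of a normal tensor field. At `x` it is computed in the transverse
coordinates given by some `f_i` defined at `x` and the chart of `N` at `f_i(x)`; being a
coordinate expression of a tensor, the value does not depend on these coordinates. -/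
def basicLaplacian (F : Foliation m q M N ι) (g : TangentMetric m M) (g₀ : TangentMetric q N)
    {p : ℕ} (T : F.NormalTensor p) : F.NormalTensor p := fun x =>
  F.laplacianIn g g₀ (F.f (F.exists_mem x).choose x) T (F.exists_mem x).choose_spec

end Foliation

end

/-! Since `∇T = 0`, the Leibniz rule gives `∇^i∇_i (T ⊗ U) = T ⊗ ∇^i∇_i U`, so everything rests on
the curvature terms of `Δ_b`. A parallel tensor is annihilated by the curvature operators, `∑ j, ∑
d, R(∂_a, ∂_b)_{c_j}^d T_{… d …} = 0` (`sum_curvCoeff_mul_comp_eq_zero`).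

Split the slots of `T ⊗ U` into those of `T` and those of `U`. For a fixed slot of `U`, the mixed
curvature terms summed over the slots of `T` are a curvature operator acting on `T`, hence vanish
(`sum_riemann_right_mul_eq_zero`, and `sum_riemann_left_mul_eq_zero` by pair symmetry). With both
slots in `T`, fix the first one, `j`: annihilation replaces the sum over `k ≠ j` by minus the term
`k = j`, whose contraction is the Ricci term at `j`. So the Ricci and Riemann terms of `T` cancel
(`sum_ricci_eq_sum_riemann`), and only `T ⊗ Δ_b U` survives.

The annihilation itself is `d² = 0`: `∇T = 0` writes the differential of each component of `T` as a
combination of the `du^a`, where `u` denotes the transverse coordinates, and the symmetry of its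
second derivative is the curvature identity (`sum_connCurv_mul_eq_zero`). The same theorem applied
to the metric tensor yields the antisymmetry of `riemann` in its last two indices.

All this needs differentiable components, hence a smooth horizontal frame. The frame is defined by a
pointwise choice; it is smooth because it solves a linear system with smooth invertible
coefficients. -/

noncomputable section

/-! ### Closed forms and the curvature identity for parallel tensors -/

section Calculus

variable {q : ℕ} {E : Type*} [NormedAddCommGroup E] [NormedSpace ℝ E]

/-- If `df = ∑ a, η_a du^a`, then `∑ a, dη_a ∧ du^a = 0`. -/
lemma sum_fderiv_mul_comm_of_fderiv_eq {f : E → ℝ} {u : E → Coord q} {η : Fin q → E → ℝ} {z : E}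
    (hf : ContDiffAt ℝ 2 f z) (hu : ContDiffAt ℝ 2 u z) (hη : ∀ a, DifferentiableAt ℝ (η a) z)
    (h : ∀ᶠ y in 𝓝 z, ∀ v, fderiv ℝ f y v = ∑ a, η a y * (fderiv ℝ u y v) a) (v w : E) :
    ∑ a, fderiv ℝ (η a) z v * (fderiv ℝ u z w) a
      = ∑ a, fderiv ℝ (η a) z w * (fderiv ℝ u z v) a := by
  have hsf : IsSymmSndFDerivAt ℝ f z := hf.isSymmSndFDerivAt (by simp)
  have hsu : IsSymmSndFDerivAt ℝ u z := hu.isSymmSndFDerivAt (by simp)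
  have hdu : DifferentiableAt ℝ (fderiv ℝ u) z :=
    (hu.fderiv_right (m := 1) (by norm_num)).differentiableAt (by norm_num)
  have hdf : DifferentiableAt ℝ (fderiv ℝ f) z :=
    (hf.fderiv_right (m := 1) (by norm_num)).differentiableAt (by norm_num)
  have key : ∀ v w, fderiv ℝ (fderiv ℝ f) z v w
      = ∑ a, (η a z * (fderiv ℝ (fderiv ℝ u) z v w) a
          + fderiv ℝ (η a) z v * (fderiv ℝ u z w) a) := by
    intro v w
    have h1 : (fun y => fderiv ℝ f y w) =ᶠ[𝓝 z] fun y => ∑ a, η a y * (fderiv ℝ u y w) a :=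
      h.mono fun y hy => hy w
    have h2 : HasFDerivAt (fun y => fderiv ℝ f y w)
        ((fderiv ℝ (fderiv ℝ f) z).flip w) z := by
      simpa using hdf.hasFDerivAt.clm_apply (hasFDerivAt_const w z)
    have h3 : ∀ a, HasFDerivAt (fun y => (fderiv ℝ u y w) a)
        ((EuclideanSpace.proj a : Coord q →L[ℝ] ℝ) ∘L (fderiv ℝ (fderiv ℝ u) z).flip w) z := by
      intro a
      have : HasFDerivAt (fun y => fderiv ℝ u y w) ((fderiv ℝ (fderiv ℝ u) z).flip w) z := by
        simpa using hdu.hasFDerivAt.clm_apply (hasFDerivAt_const w z)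
      exact (EuclideanSpace.proj a : Coord q →L[ℝ] ℝ).hasFDerivAt.comp z this
    have h4 := HasFDerivAt.fun_sum (u := Finset.univ)
      fun a _ => (hη a).hasFDerivAt.mul (h3 a)
    have h5 := congrArg (fun L => L v) ((h2.congr_of_eventuallyEq h1.symm).unique h4)
    simp only [ContinuousLinearMap.flip_apply, sum_apply,
      add_apply, smul_apply,
      ContinuousLinearMap.comp_apply, smul_eq_mul] at h5
    rw [h5]
    refine Finset.sum_congr rfl fun a _ => ?_
    simp [mul_comm]
  -- The Hessians of `f` and `u` are symmetric, so exchanging `v` and `w` leaves only the terms with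
  -- derivatives of `η`.
  have h1 := key v w
  have h2 := key w v
  rw [hsf v w, h2] at h1
  simp only [Finset.sum_add_distrib] at h1
  rw [hsu v w] at h1
  linarith

lemma fderiv_comp_eq_sum_partialDeriv {φ : Coord q → ℝ} {u : E → Coord q} {z : E}
    (hφ : DifferentiableAt ℝ φ (u z)) (hu : DifferentiableAt ℝ u z) {v : E} {a : Fin q}
    (hv : fderiv ℝ u z v = EuclideanSpace.single a 1) :
    fderiv ℝ (fun y => φ (u y)) z v = partialDeriv a φ (u z) := by
  have := fderiv_comp z hφ hu
  simp only [Function.comp_def] at this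
  rw [this, ContinuousLinearMap.comp_apply, hv, partialDeriv]

/-- The coefficients of the curvature operator of the connection with coefficients `Γ`. -/
def connCurv (Γ : Fin q → Fin q → Fin q → Coord q → ℝ) (a b c d : Fin q) (z : Coord q) : ℝ :=
  partialDeriv a (Γ b c d) z - partialDeriv b (Γ a c d) z
    + ∑ e, (Γ a e d z * Γ b c e z - Γ b e d z * Γ a c e z)

/-- Two successive slotwise actions, first `B`, then `A`: the second either hits the slot just
changed, which gives a matrix product, or a different one. -/
lemma sum_update_update_split {p : ℕ} (A B : Fin q → Fin q → ℝ) (t : (Fin p → Fin q) → ℝ)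
    (c : Fin p → Fin q) :
    ∑ j, ∑ d, B (c j) d * ∑ k, ∑ e, A (Function.update c j d k) e
        * t (Function.update (Function.update c j d) k e)
      = ∑ j, ∑ d, (∑ e, A e d * B (c j) e) * t (Function.update c j d)
        + ∑ j, ∑ k ∈ Finset.univ.erase j, ∑ d, ∑ e, B (c j) d * A (c k) e
          * t (Function.update (Function.update c j d) k e) := by
  rw [← Finset.sum_add_distrib]
  refine Finset.sum_congr rfl fun j _ => ?_
  have : ∀ d, ∑ k, ∑ e, A (Function.update c j d k) e
        * t (Function.update (Function.update c j d) k e)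
      = ∑ e, A d e * t (Function.update c j e) + ∑ k ∈ Finset.univ.erase j, ∑ e, A (c k) e
          * t (Function.update (Function.update c j d) k e) := by
    intro d
    rw [← Finset.add_sum_erase _ _ (Finset.mem_univ j)]
    congr 1
    · simp
    · refine Finset.sum_congr rfl fun k hk => ?_
      rw [Function.update_of_ne (Finset.ne_of_mem_erase hk)]
  simp only [this, mul_add, Finset.sum_add_distrib]
  congr 1
  · simp only [Finset.mul_sum, Finset.sum_mul]
    rw [Finset.sum_comm]
    refine Finset.sum_congr rfl fun d _ => Finset.sum_congr rfl fun e _ => by ring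
  · simp only [Finset.mul_sum]
    rw [Finset.sum_comm]
    refine Finset.sum_congr rfl fun k _ => Finset.sum_congr rfl fun d _ =>
      Finset.sum_congr rfl fun e _ => by ring

lemma sum_erase_comm {p : ℕ} (f : Fin p → Fin p → ℝ) :
    ∑ j, ∑ k ∈ Finset.univ.erase j, f j k = ∑ j, ∑ k ∈ Finset.univ.erase j, f k j := by
  refine Finset.sum_comm' ?_
  simp [eq_comm]

/-- Substitutions in different slots commute, so this part drops out of a commutator of two slotwise
actions. -/
lemma sum_update_update_comm {p : ℕ} (A B : Fin q → Fin q → ℝ) (t : (Fin p → Fin q) → ℝ)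
    (c : Fin p → Fin q) :
    ∑ j, ∑ k ∈ Finset.univ.erase j, ∑ d, ∑ e, B (c j) d * A (c k) e
          * t (Function.update (Function.update c j d) k e)
      = ∑ j, ∑ k ∈ Finset.univ.erase j, ∑ d, ∑ e, A (c j) d * B (c k) e
          * t (Function.update (Function.update c j d) k e) := by
  rw [sum_erase_comm]
  refine Finset.sum_congr rfl fun j _ => Finset.sum_congr rfl fun k hk => ?_
  rw [Finset.sum_comm]
  refine Finset.sum_congr rfl fun d _ => Finset.sum_congr rfl fun e _ => ?_
  rw [Function.update_comm (Finset.ne_of_mem_erase hk)]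
  ring

/-- The curvature annihilates the components of a parallel tensor. -/
theorem sum_connCurv_mul_eq_zero {p : ℕ} {Γ : Fin q → Fin q → Fin q → Coord q → ℝ}
    {u : E → Coord q} {t : (Fin p → Fin q) → E → ℝ} {z : E}
    (hΓ : ∀ a b d, DifferentiableAt ℝ (Γ a b d) (u z)) (hu : ContDiffAt ℝ 2 u z)
    (ht : ∀ c, ContDiffAt ℝ 2 (t c) z) (hsurj : Function.Surjective (fderiv ℝ u z))
    (h : ∀ᶠ y in 𝓝 z, ∀ c v, fderiv ℝ (t c) y v =
      ∑ j, ∑ a, ∑ d, (fderiv ℝ u y v) a * Γ a (c j) d (u y) * t (Function.update c j d) y)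
    (a b : Fin q) (c : Fin p → Fin q) :
    ∑ j, ∑ d, connCurv Γ a b (c j) d (u z) * t (Function.update c j d) z = 0 := by
  have hu' : DifferentiableAt ℝ u z := hu.differentiableAt (by norm_num)
  have ht' : ∀ c, DifferentiableAt ℝ (t c) z := fun c => (ht c).differentiableAt (by norm_num)
  have hΓu : ∀ a b d, DifferentiableAt ℝ (fun y => Γ a b d (u y)) z := fun a b d =>
    (hΓ a b d).comp z hu'
  -- `η c a` is the coefficient of `du^a` in the differential of `t c`.
  set η : (Fin p → Fin q) → Fin q → E → ℝ := fun c a y =>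
    ∑ j, ∑ d, Γ a (c j) d (u y) * t (Function.update c j d) y with hηdef
  have hη : ∀ c a, DifferentiableAt ℝ (η c a) z := fun c a =>
    DifferentiableAt.fun_sum fun j _ => DifferentiableAt.fun_sum fun d _ =>
      (hΓu _ _ _).mul (ht' _)
  have h' : ∀ᶠ y in 𝓝 z, ∀ c v, fderiv ℝ (t c) y v = ∑ a, η c a y * (fderiv ℝ u y v) a := by
    filter_upwards [h] with y hy c v
    rw [hy, Finset.sum_comm]
    refine Finset.sum_congr rfl fun a _ => ?_
    simp only [hηdef, Finset.sum_mul]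
    refine Finset.sum_congr rfl fun j _ => Finset.sum_congr rfl fun d _ => by ring
  -- Lifts of `∂_a` and `∂_b`: evaluated on them, the closedness relation becomes `dη_b(v) =
  -- dη_a(w)`.
  obtain ⟨v, hv⟩ := hsurj (EuclideanSpace.single a 1)
  obtain ⟨w, hw⟩ := hsurj (EuclideanSpace.single b 1)
  have hclosed := sum_fderiv_mul_comm_of_fderiv_eq (ht c) hu (hη c) (h'.mono fun y hy => hy c) v w
  have hdt : ∀ (c : Fin p → Fin q) {v : E} {a : Fin q},
      fderiv ℝ u z v = EuclideanSpace.single a 1 → fderiv ℝ (t c) z v = η c a z := by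
    intro c v a hv
    rw [h'.self_of_nhds c v, hv]
    simp [PiLp.single_apply]
  have hdη : ∀ {v : E} {a : Fin q} (b : Fin q),
      fderiv ℝ u z v = EuclideanSpace.single a 1 → fderiv ℝ (η c b) z v =
        ∑ j, ∑ d, partialDeriv a (Γ b (c j) d) (u z) * t (Function.update c j d) z
        + ∑ j, ∑ d, Γ b (c j) d (u z) * η (Function.update c j d) a z := by
    intro v a b hv
    have := HasFDerivAt.fun_sum (u := Finset.univ) fun j _ =>
      HasFDerivAt.fun_sum (u := Finset.univ) fun d _ =>
        (hΓu b (c j) d).hasFDerivAt.mul (ht' (Function.update c j d)).hasFDerivAt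
    rw [HasFDerivAt.fderiv (f := η c b) this, ← Finset.sum_add_distrib]
    simp only [sum_apply, add_apply,
      smul_apply, smul_eq_mul, ← Finset.sum_add_distrib]
    refine Finset.sum_congr rfl fun j _ => Finset.sum_congr rfl fun d _ => ?_
    rw [hdt _ hv, fderiv_comp_eq_sum_partialDeriv (hΓ _ _ _) hu' hv]
    ring
  simp only [hv, hw, PiLp.single_apply, mul_ite, mul_one, mul_zero, Finset.sum_ite_eq',
    Finset.mem_univ, if_true] at hclosed
  rw [hdη b hv, hdη a hw] at hclosed
  simp only [hηdef] at hclosed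
  -- The same-slot parts supply the terms quadratic in `Γ` of the curvature; the parts with two
  -- different slots cancel by `s3`.
  have s1 := sum_update_update_split (fun x y => Γ a x y (u z)) (fun x y => Γ b x y (u z))
    (fun c => t c z) c
  have s2 := sum_update_update_split (fun x y => Γ b x y (u z)) (fun x y => Γ a x y (u z))
    (fun c => t c z) c
  have s3 := sum_update_update_comm (fun x y => Γ a x y (u z)) (fun x y => Γ b x y (u z))
    (fun c => t c z) c
  rw [s1, s2, s3] at hclosed
  simp only [connCurv, add_mul, sub_mul, Finset.sum_add_distrib, Finset.sum_sub_distrib]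
  linarith

end Calculus

/-! ### Orthogonal lifts as solutions of a linear system -/

section Saddle

variable {E F : Type*} [NormedAddCommGroup E] [NormedSpace ℝ E] [NormedAddCommGroup F]
  [NormedSpace ℝ F]

/-- The operator `(v, l) ↦ (G v + l ∘ A, A v)` of the minimisation problem of `G` on the fibres
of `A`. -/
def saddleMap (G : E →L[ℝ] E →L[ℝ] ℝ) (A : E →L[ℝ] F) :
    (E × (F →L[ℝ] ℝ)) →L[ℝ] ((E →L[ℝ] ℝ) × F) :=
  ContinuousLinearMap.inl ℝ (E →L[ℝ] ℝ) F ∘L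
      (G ∘L ContinuousLinearMap.fst ℝ E (F →L[ℝ] ℝ)
        + (ContinuousLinearMap.compL ℝ E F ℝ).flip A ∘L ContinuousLinearMap.snd ℝ E (F →L[ℝ] ℝ))
    + ContinuousLinearMap.inr ℝ (E →L[ℝ] ℝ) F ∘L A ∘L ContinuousLinearMap.fst ℝ E (F →L[ℝ] ℝ)

lemma saddleMap_apply (G : E →L[ℝ] E →L[ℝ] ℝ) (A : E →L[ℝ] F) (y : E × (F →L[ℝ] ℝ)) :
    saddleMap G A y = (G y.1 + y.2 ∘L A, A y.1) := by
  simp [saddleMap]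

/-- Source and target have equal dimension, so a trivial kernel suffices. On the kernel `A v = 0`,
and pairing the first equation with `v` removes the multiplier `l`, leaving `G v v = 0`; then `l ∘ A
= 0` with `A` onto. -/
lemma saddleMap_isInvertible [FiniteDimensional ℝ E] [FiniteDimensional ℝ F]
    {G : E →L[ℝ] E →L[ℝ] ℝ} {A : E →L[ℝ] F} (hG : ∀ v, v ≠ 0 → 0 < G v v)
    (hA : Function.Surjective A) : (saddleMap G A).IsInvertible := by
  have hinj : Function.Injective (saddleMap G A).toLinearMap := by
    rw [← LinearMap.ker_eq_bot, LinearMap.ker_eq_bot']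
    rintro ⟨v, l⟩ h
    rw [ContinuousLinearMap.coe_coe, saddleMap_apply, Prod.mk_eq_zero] at h
    obtain ⟨h1, h2⟩ := h
    simp only at h1 h2
    have hv : v = 0 := by
      by_contra hv
      have h3 := DFunLike.congr_fun h1 v
      simp only [add_apply, ContinuousLinearMap.comp_apply, h2, map_zero, add_zero,
        zero_apply] at h3
      exact (hG v hv).ne' h3
    subst hv
    refine Prod.mk_eq_zero.2 ⟨rfl, ?_⟩
    ext w
    obtain ⟨v, rfl⟩ := hA w
    simpa using DFunLike.congr_fun h1 v
  have hdual : ∀ (V : Type _) [NormedAddCommGroup V] [NormedSpace ℝ V] [FiniteDimensional ℝ V],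
      Module.finrank ℝ (V →L[ℝ] ℝ) = Module.finrank ℝ V := fun V _ _ _ => by
    rw [← (LinearMap.toContinuousLinearMap (𝕜 := ℝ) (E := V) (F' := ℝ)).finrank_eq]
    exact Subspace.dual_finrank_eq
  have hdim : Module.finrank ℝ (E × (F →L[ℝ] ℝ)) = Module.finrank ℝ ((E →L[ℝ] ℝ) × F) := by
    rw [Module.finrank_prod, Module.finrank_prod, hdual]
    congr 1
    rw [← (LinearMap.toContinuousLinearMap (𝕜 := ℝ) (E := E) (F' := ℝ)).finrank_eq]
    exact Subspace.dual_finrank_eq.symm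
  refine ⟨(LinearEquiv.ofInjectiveOfFinrankEq (saddleMap G A).toLinearMap hinj
    hdim).toContinuousLinearEquiv, ?_⟩
  ext v <;> rfl

/-- The point of the fibre of `A` over `y` that is `G`-orthogonal to the kernel of `A`. -/
def saddleSol (G : E →L[ℝ] E →L[ℝ] ℝ) (A : E →L[ℝ] F) (y : F) : E :=
  ((saddleMap G A).inverse (0, y)).1

lemma saddleSol_spec [FiniteDimensional ℝ E] [FiniteDimensional ℝ F]
    {G : E →L[ℝ] E →L[ℝ] ℝ} {A : E →L[ℝ] F} (hG : ∀ v, v ≠ 0 → 0 < G v v)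
    (hA : Function.Surjective A) (y : F) :
    A (saddleSol G A y) = y ∧ ∀ u, A u = 0 → G (saddleSol G A y) u = 0 := by
  have h : saddleMap G A ((saddleMap G A).inverse (0, y)) = (0, y) := by
    obtain ⟨e, he⟩ := saddleMap_isInvertible hG hA
    rw [← he]
    simp
  rw [saddleMap_apply, Prod.mk.injEq] at h
  refine ⟨h.2, fun u hu => ?_⟩
  have h1 := DFunLike.congr_fun h.1 u
  rwa [add_apply, ContinuousLinearMap.comp_apply, hu, map_zero, add_zero] at h1

-- Operator inversion is smooth at invertible operators, so the solution depends smoothly on the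
-- coefficients `G` and `A`.
set_option synthInstance.maxHeartbeats 200000 in
lemma ContDiffAt.saddleSol {D : Type*} [NormedAddCommGroup D] [NormedSpace ℝ D]
    [FiniteDimensional ℝ E] [FiniteDimensional ℝ F] {n : WithTop ℕ∞}
    {G : D → E →L[ℝ] E →L[ℝ] ℝ} {A : D → E →L[ℝ] F} {z : D}
    (hG : ContDiffAt ℝ n G z) (hA : ContDiffAt ℝ n A z) (hpos : ∀ v, v ≠ 0 → 0 < G z v v)
    (hsurj : Function.Surjective (A z)) (y : F) :
    ContDiffAt ℝ n (fun w => _root_.saddleSol (G w) (A w) y) z := by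
  have : CompleteSpace E := FiniteDimensional.complete ℝ E
  have : CompleteSpace (F →L[ℝ] ℝ) := FiniteDimensional.complete ℝ _
  have h1 : ContDiffAt ℝ n (fun w => saddleMap (G w) (A w)) z := by
    unfold saddleMap
    refine ContDiffAt.add (contDiffAt_const.clm_comp (ContDiffAt.add (hG.clm_comp contDiffAt_const)
      (ContDiffAt.clm_comp ?_ contDiffAt_const)))
      (contDiffAt_const.clm_comp (hA.clm_comp contDiffAt_const))
    exact ContDiffAt.clm_apply contDiffAt_const hA
  have h2 := ((saddleMap_isInvertible hpos hsurj).contDiffAt_map_inverse (n := n)).comp z h1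
  exact contDiffAt_fst.comp z (h2.clm_apply contDiffAt_const)

end Saddle

/-! ### Tangent vectors, derivatives and metrics read in a chart -/

section Chart

variable {n : ℕ} {X : Type*} [TopologicalSpace X] [ChartedSpace (Coord n) X]

/-- The differential at `x` of the chart at `x₀`. -/
def chartDeriv (x₀ x : X) : TangentSpace (𝓡 n) x →L[ℝ] Coord n :=
  mfderiv (𝓡 n) 𝓘(ℝ, Coord n) (extChartAt (𝓡 n) x₀) x

/-- The inverse of the differential at `x` of the chart at `x₀`. -/
def chartDerivSymm (x₀ x : X) : Coord n →L[ℝ] TangentSpace (𝓡 n) x :=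
  mfderiv 𝓘(ℝ, Coord n) (𝓡 n) (extChartAt (𝓡 n) x₀).symm (extChartAt (𝓡 n) x₀ x)

variable [IsManifold (𝓡 n) ∞ X]

lemma contDiffAt_comp_extChartAt_symm {F : Type*} [NormedAddCommGroup F] [NormedSpace ℝ F]
    {k : ℕ∞} {f : X → F} {x₀ x : X} (hx : x ∈ (extChartAt (𝓡 n) x₀).source)
    (hf : ContMDiffAt (𝓡 n) 𝓘(ℝ, F) k f x) :
    ContDiffAt ℝ k (f ∘ (extChartAt (𝓡 n) x₀).symm) (extChartAt (𝓡 n) x₀ x) := by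
  rw [← contMDiffAt_iff_contDiffAt]
  refine ContMDiffAt.comp (I' := 𝓡 n) _ ?_ ?_
  · rwa [(extChartAt (𝓡 n) x₀).left_inv hx]
  · exact ((contMDiffOn_extChartAt_symm (n := ∞) x₀).contMDiffAt
      (extChartAt_target_mem_nhds' ((extChartAt (𝓡 n) x₀).map_source hx))).of_le
        (by exact_mod_cast le_top)

lemma contMDiffAt_comp_extChartAt {F : Type*} [NormedAddCommGroup F] [NormedSpace ℝ F]
    {k : ℕ∞} {f : Coord n → F} {x₀ x : X} (hx : x ∈ (extChartAt (𝓡 n) x₀).source)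
    (hf : ContDiffAt ℝ k f (extChartAt (𝓡 n) x₀ x)) :
    ContMDiffAt (𝓡 n) 𝓘(ℝ, F) k (fun y => f (extChartAt (𝓡 n) x₀ y)) x := by
  refine ContMDiffAt.comp (I' := 𝓘(ℝ, Coord n)) x hf.contMDiffAt ?_
  rw [extChartAt_source] at hx
  exact (contMDiffAt_extChartAt' (n := ∞) hx).of_le (by exact_mod_cast le_top)

lemma chartDeriv_chartDerivSymm {x₀ x : X} (hx : x ∈ (extChartAt (𝓡 n) x₀).source)
    (v : Coord n) : chartDeriv x₀ x (chartDerivSymm x₀ x v) = v := by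
  have : IsManifold (𝓡 n) 1 X := IsManifold.of_le (n := ∞) (by norm_num)
  have := mfderiv_extChartAt_comp_mfderivWithin_extChartAt_symm' (I := 𝓡 n) hx
  simp only [modelWithCornersSelf_coe, range_id, mfderivWithin_univ] at this
  exact DFunLike.congr_fun this v

lemma chartDerivSymm_chartDeriv {x₀ x : X} (hx : x ∈ (extChartAt (𝓡 n) x₀).source)
    (v : TangentSpace (𝓡 n) x) : chartDerivSymm x₀ x (chartDeriv x₀ x v) = v := by
  have : IsManifold (𝓡 n) 1 X := IsManifold.of_le (n := ∞) (by norm_num)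
  have := mfderivWithin_extChartAt_symm_comp_mfderiv_extChartAt' (I := 𝓡 n) hx
  simp only [modelWithCornersSelf_coe, range_id, mfderivWithin_univ] at this
  exact DFunLike.congr_fun this v

lemma mfderiv_eq_fderiv_comp_extChartAt_symm {F : Type*} [NormedAddCommGroup F] [NormedSpace ℝ F]
    {f : X → F} {x₀ x : X} (hx : x ∈ (extChartAt (𝓡 n) x₀).source)
    (hf : MDifferentiableAt (𝓡 n) 𝓘(ℝ, F) f x) (v : Coord n) :
    mfderiv (𝓡 n) 𝓘(ℝ, F) f x (chartDerivSymm x₀ x v)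
      = fderiv ℝ (f ∘ (extChartAt (𝓡 n) x₀).symm) (extChartAt (𝓡 n) x₀ x) v := by
  have : IsManifold (𝓡 n) 1 X := IsManifold.of_le (n := ∞) (by norm_num)
  have hinv := (extChartAt (𝓡 n) x₀).left_inv hx
  have hs : MDifferentiableAt 𝓘(ℝ, Coord n) (𝓡 n) (extChartAt (𝓡 n) x₀).symm
      (extChartAt (𝓡 n) x₀ x) := by
    have := mdifferentiableWithinAt_extChartAt_symm (I := 𝓡 n)
      ((extChartAt (𝓡 n) x₀).map_source hx)
    simpa only [modelWithCornersSelf_coe, range_id, mdifferentiableWithinAt_univ] using this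
  rw [← mfderiv_eq_fderiv, mfderiv_comp (I' := 𝓡 n) _ (by rwa [hinv]) hs, hinv]
  rfl

/-- A vector field is smooth if its components in a chart are. -/
lemma contMDiffAt_chartDerivSymm {ξ : X → Coord n} {x₀ x : X}
    (hx : x ∈ (extChartAt (𝓡 n) x₀).source) (hξ : ContMDiffAt (𝓡 n) 𝓘(ℝ, Coord n) ∞ ξ x) :
    ContMDiffAt (𝓡 n) (𝓡 n).tangent ∞
      (fun y => (⟨y, chartDerivSymm x₀ y (ξ y)⟩ : TangentBundle (𝓡 n) X)) x := by
  have : IsManifold (𝓡 n) 1 X := IsManifold.of_le (n := ∞) (by norm_num)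
  have hx' : x ∈ (trivializationAt (Coord n) (TangentSpace (𝓡 n)) x₀).baseSet := by
    simpa using hx
  refine ((trivializationAt (Coord n) (TangentSpace (𝓡 n)) x₀).contMDiffAt_section_iff hx').2 ?_
  refine hξ.congr_of_eventuallyEq ?_
  filter_upwards [(isOpen_extChartAt_source x₀).mem_nhds hx] with y hy
  have hy' : y ∈ (chartAt (Coord n) x₀).source := by simpa using hy
  have h1 := chartDeriv_chartDerivSymm hy (ξ y)
  have h2 := TangentBundle.continuousLinearMapAt_trivializationAt (I := 𝓡 n) hy'
  have hy'' : y ∈ (trivializationAt (Coord n) (TangentSpace (𝓡 n)) x₀).baseSet := by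
    simpa using hy
  rw [chartDeriv, ← h2, Trivialization.continuousLinearMapAt_apply,
    Trivialization.linearMapAt_apply, if_pos hy''] at h1
  exact h1

lemma TangentMetric.contMDiffAt_inner (g : TangentMetric n X)
    {V W : ∀ x : X, TangentSpace (𝓡 n) x} {x : X}
    (hV : ContMDiffAt (𝓡 n) (𝓡 n).tangent ∞ (fun y => (⟨y, V y⟩ : TangentBundle (𝓡 n) X)) x)
    (hW : ContMDiffAt (𝓡 n) (𝓡 n).tangent ∞ (fun y => (⟨y, W y⟩ : TangentBundle (𝓡 n) X)) x) :
    ContMDiffAt (𝓡 n) 𝓘(ℝ, ℝ) ∞ (fun y => g.inner y (V y) (W y)) x := by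
  have : ContMDiffAt (𝓡 n) ((𝓡 n).prod 𝓘(ℝ, ℝ)) ∞
      (fun y => (⟨y, g.inner y (V y) (W y)⟩ : TotalSpace ℝ (Bundle.Trivial X ℝ))) x :=
    ContMDiffAt.clm_bundle_apply₂ (F₁ := Coord n) (F₂ := Coord n) (g.contMDiff x) hV hW
  simp only [contMDiffAt_totalSpace] at this
  exact this.2

/-- The metric in the chart at `x₀`. -/
def chartMetric (g : TangentMetric n X) (x₀ x : X) : Coord n →L[ℝ] Coord n →L[ℝ] ℝ :=
  ContinuousLinearMap.bilinearComp (show Coord n →L[ℝ] Coord n →L[ℝ] ℝ from g.inner x)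
    (show Coord n →L[ℝ] Coord n from chartDerivSymm x₀ x)
    (show Coord n →L[ℝ] Coord n from chartDerivSymm x₀ x)

lemma chartMetric_apply (g : TangentMetric n X) (x₀ x : X) (v w : Coord n) :
    chartMetric g x₀ x v w = g.inner x (chartDerivSymm x₀ x v) (chartDerivSymm x₀ x w) :=
  rfl

lemma chartMetric_pos (g : TangentMetric n X) {x₀ x : X}
    (hx : x ∈ (extChartAt (𝓡 n) x₀).source) {v : Coord n} (hv : v ≠ 0) :
    0 < chartMetric g x₀ x v v := by
  rw [chartMetric_apply]
  refine g.pos x _ fun h => hv ?_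
  rw [← chartDeriv_chartDerivSymm hx v, h, map_zero]

/-- In finite dimension, smoothness of an operator-valued map may be tested on fixed vectors; there
it is the metric paired with two smooth coordinate fields. -/
lemma contDiffAt_chartMetric (g : TangentMetric n X) {x₀ x : X}
    (hx : x ∈ (extChartAt (𝓡 n) x₀).source) :
    ContDiffAt ℝ ∞ (chartMetric g x₀ ∘ (extChartAt (𝓡 n) x₀).symm) (extChartAt (𝓡 n) x₀ x) := by
  have : ContDiffOn ℝ ∞ (chartMetric g x₀ ∘ (extChartAt (𝓡 n) x₀).symm)
      (extChartAt (𝓡 n) x₀).target := by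
    refine contDiffOn_clm_apply.2 fun v => contDiffOn_clm_apply.2 fun w z hz => ?_
    have hy := (extChartAt (𝓡 n) x₀).map_target hz
    have h1 := g.contMDiffAt_inner (contMDiffAt_chartDerivSymm hy contMDiffAt_const)
      (contMDiffAt_chartDerivSymm hy contMDiffAt_const) (V := fun y => chartDerivSymm x₀ y v)
      (W := fun y => chartDerivSymm x₀ y w)
    have h2 := contDiffAt_comp_extChartAt_symm hy h1
    rw [(extChartAt (𝓡 n) x₀).right_inv hz] at h2
    exact h2.contDiffWithinAt
  exact this.contDiffAt (extChartAt_target_mem_nhds' ((extChartAt (𝓡 n) x₀).map_source hx))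

end Chart

/-! ### Levi-Civita calculus: metricity and the symmetries of the curvature tensor -/

section LeviCivita

variable {q : ℕ} {N : Type*} [TopologicalSpace N] [ChartedSpace (Coord q) N]
  [IsManifold (𝓡 q) ∞ N]

lemma fderiv_eq_sum_partialDeriv (f : Coord q → ℝ) (z v : Coord q) :
    fderiv ℝ f z v = ∑ a, v a * partialDeriv a f z := by
  have hv : v = ∑ a, v a • EuclideanSpace.single a (1 : ℝ) := by
    simpa using ((EuclideanSpace.basisFun (Fin q) ℝ).sum_repr v).symm
  conv_lhs => rw [hv]
  simp [partialDeriv]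

lemma contDiffAt_partialDeriv {f : Coord q → ℝ} {z : Coord q} (a : Fin q)
    (hf : ContDiffAt ℝ ∞ f z) : ContDiffAt ℝ ∞ (partialDeriv a f) z :=
  (hf.fderiv_right (m := ∞) (by simp)).clm_apply contDiffAt_const

lemma metricCoeff_eq_chartMetric (g : TangentMetric q N) (y₀ : N) {z : Coord q}
    (hz : z ∈ (extChartAt (𝓡 q) y₀).target) (a b : Fin q) :
    metricCoeff g y₀ z a b = chartMetric g y₀ ((extChartAt (𝓡 q) y₀).symm z)
      (EuclideanSpace.single a 1) (EuclideanSpace.single b 1) := by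
  rw [chartMetric_apply, chartDerivSymm, (extChartAt (𝓡 q) y₀).right_inv hz]
  rfl

lemma contDiffAt_metricCoeff (g : TangentMetric q N) (y₀ : N) {z : Coord q}
    (hz : z ∈ (extChartAt (𝓡 q) y₀).target) (a b : Fin q) :
    ContDiffAt ℝ ∞ (fun w => metricCoeff g y₀ w a b) z := by
  have h := contDiffAt_chartMetric g ((extChartAt (𝓡 q) y₀).map_target hz)
  rw [(extChartAt (𝓡 q) y₀).right_inv hz] at h
  refine ((h.clm_apply contDiffAt_const).clm_apply contDiffAt_const).congr_of_eventuallyEq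
    (f := fun w => chartMetric g y₀ ((extChartAt (𝓡 q) y₀).symm w)
      (EuclideanSpace.single a 1) (EuclideanSpace.single b 1)) ?_
  filter_upwards [(isOpen_extChartAt_target y₀).mem_nhds hz] with w hw
  exact metricCoeff_eq_chartMetric g y₀ hw a b

lemma metricCoeff_symm (g : TangentMetric q N) (y₀ : N) (z : Coord q) (a b : Fin q) :
    metricCoeff g y₀ z a b = metricCoeff g y₀ z b a :=
  g.symm _ _ _

/-- Positive definiteness of the metric; needed because the inverse of a singular matrix is the
default value `0`. -/
lemma isUnit_det_metricCoeff (g : TangentMetric q N) (y₀ : N) {z : Coord q}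
    (hz : z ∈ (extChartAt (𝓡 q) y₀).target) : IsUnit (metricCoeff g y₀ z).det := by
  have hpos : (metricCoeff g y₀ z).PosDef := by
    refine Matrix.PosDef.of_dotProduct_mulVec_pos ?_ fun v hv => ?_
    · ext a b
      simp [metricCoeff_symm g y₀ z b a]
    · have hv' : (∑ a, v a • EuclideanSpace.single a (1 : ℝ) : Coord q) ≠ 0 := by
        intro h
        refine hv (funext fun a => ?_)
        have := congrArg (fun w : Coord q => w a) h
        simpa [Pi.single_apply] using this
      have := chartMetric_pos g ((extChartAt (𝓡 q) y₀).map_target hz) hv'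
      simp only [map_sum, map_smul, sum_apply, smul_apply, smul_eq_mul,
        ← metricCoeff_eq_chartMetric g y₀ hz] at this
      simp only [dotProduct, Matrix.mulVec, star_trivial]
      simpa only [mul_comm (metricCoeff g y₀ z _ _), metricCoeff_symm g y₀ z] using this
  exact hpos.det_pos.ne'.isUnit

lemma metricInv_symm (g : TangentMetric q N) (y₀ : N) (z : Coord q) (a b : Fin q) :
    metricInv g y₀ z a b = metricInv g y₀ z b a := by
  have h : (metricCoeff g y₀ z).transpose = metricCoeff g y₀ z := by
    ext a b
    exact metricCoeff_symm g y₀ z b a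
  have := Matrix.transpose_nonsing_inv (metricCoeff g y₀ z)
  rw [h] at this
  exact congrFun (congrFun this b) a

lemma sum_metricCoeff_mul_metricInv (g : TangentMetric q N) (y₀ : N) {z : Coord q}
    (hz : z ∈ (extChartAt (𝓡 q) y₀).target) (a b : Fin q) :
    ∑ e, metricCoeff g y₀ z a e * metricInv g y₀ z e b = if a = b then 1 else 0 := by
  have := Matrix.mul_nonsing_inv _ (isUnit_det_metricCoeff g y₀ hz)
  rw [← Matrix.one_apply, ← this, Matrix.mul_apply]
  rfl

lemma sum_sum_metricCoeff_mul_metricInv (g : TangentMetric q N) (y₀ : N) {z : Coord q}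
    (hz : z ∈ (extChartAt (𝓡 q) y₀).target) (f : Fin q → ℝ) (b : Fin q) :
    ∑ x, (∑ e, f e * metricCoeff g y₀ z e x) * metricInv g y₀ z x b = f b := by
  simp only [Finset.sum_mul]
  rw [Finset.sum_comm]
  simp only [mul_assoc, ← Finset.mul_sum, sum_metricCoeff_mul_metricInv g y₀ hz]
  simp

lemma sum_sum_metricInv_mul_metricCoeff (g : TangentMetric q N) (y₀ : N) {z : Coord q}
    (hz : z ∈ (extChartAt (𝓡 q) y₀).target) (f : Fin q → ℝ) (b : Fin q) :
    ∑ d, (∑ k, metricInv g y₀ z d k * f k) * metricCoeff g y₀ z d b = f b := by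
  have : ∀ k, ∑ d, metricInv g y₀ z d k * metricCoeff g y₀ z d b = if b = k then 1 else 0 := by
    intro k
    rw [← sum_metricCoeff_mul_metricInv g y₀ hz]
    refine Finset.sum_congr rfl fun d _ => ?_
    rw [metricCoeff_symm, mul_comm]
  simp only [Finset.sum_mul]
  rw [Finset.sum_comm]
  simp only [mul_right_comm _ (f _), ← Finset.sum_mul, this]
  simp

lemma contDiffAt_det {D : Type*} [NormedAddCommGroup D] [NormedSpace ℝ D]
    {A : D → Matrix (Fin q) (Fin q) ℝ} {z : D}
    (hA : ∀ a b, ContDiffAt ℝ ∞ (fun w => A w a b) z) :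
    ContDiffAt ℝ ∞ (fun w => (A w).det) z := by
  simp only [Matrix.det_apply]
  exact ContDiffAt.sum fun σ _ => (contDiffAt_prod fun i _ => hA _ _).const_smul _

/-- Cramer's rule: each entry is a determinant, with one row replaced by a constant one, divided by
the nonvanishing determinant of the metric. -/
lemma contDiffAt_metricInv (g : TangentMetric q N) (y₀ : N) {z : Coord q}
    (hz : z ∈ (extChartAt (𝓡 q) y₀).target) (a b : Fin q) :
    ContDiffAt ℝ ∞ (fun w => metricInv g y₀ w a b) z := by
  have h := contDiffAt_metricCoeff g y₀ hz
  simp only [metricInv, Matrix.inv_def, Matrix.smul_apply, Ring.inverse_eq_inv', smul_eq_mul,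
    Matrix.adjugate_apply]
  refine ((contDiffAt_det h).inv (isUnit_det_metricCoeff g y₀ hz).ne_zero).mul
    (contDiffAt_det fun c d => ?_)
  by_cases hc : c = b
  · subst hc
    simp only [Matrix.updateRow_self]
    exact contDiffAt_const
  · simp only [Matrix.updateRow_ne hc]
    exact h c d

lemma contDiffAt_christoffel (g : TangentMetric q N) (y₀ : N) {z : Coord q}
    (hz : z ∈ (extChartAt (𝓡 q) y₀).target) (a b d : Fin q) :
    ContDiffAt ℝ ∞ (christoffel g y₀ a b d) z := by
  have h := contDiffAt_metricCoeff g y₀ hz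
  unfold christoffel
  exact contDiffAt_const.mul (ContDiffAt.sum fun k _ => (contDiffAt_metricInv g y₀ hz d k).mul
    (((contDiffAt_partialDeriv a (h b k)).add (contDiffAt_partialDeriv b (h a k))).sub
      (contDiffAt_partialDeriv k (h a b))))

lemma christoffel_symm (g : TangentMetric q N) (y₀ : N) (a b d : Fin q) :
    christoffel g y₀ a b d = christoffel g y₀ b a d := by
  funext z
  simp only [christoffel]
  congr 1
  refine Finset.sum_congr rfl fun k _ => ?_
  rw [show (fun w => metricCoeff g y₀ w a b) = fun w => metricCoeff g y₀ w b a from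
    funext fun w => metricCoeff_symm g y₀ w a b]
  ring

/-- Lowering the upper index cancels the inverse metric and leaves the Christoffel symbols of the
first kind. -/
lemma sum_christoffel_mul_metricCoeff (g : TangentMetric q N) (y₀ : N) {z : Coord q}
    (hz : z ∈ (extChartAt (𝓡 q) y₀).target) (a b k : Fin q) :
    ∑ d, christoffel g y₀ a b d z * metricCoeff g y₀ z d k
      = (1 / 2) * (partialDeriv a (fun w => metricCoeff g y₀ w b k) z
      + partialDeriv b (fun w => metricCoeff g y₀ w a k) z
      - partialDeriv k (fun w => metricCoeff g y₀ w a b) z) := by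
  simp only [christoffel, mul_assoc, ← Finset.mul_sum]
  rw [sum_sum_metricInv_mul_metricCoeff g y₀ hz (fun k =>
    partialDeriv a (fun w => metricCoeff g y₀ w b k) z
      + partialDeriv b (fun w => metricCoeff g y₀ w a k) z
      - partialDeriv k (fun w => metricCoeff g y₀ w a b) z)]

/-- The Levi-Civita connection is metric. -/
lemma partialDeriv_metricCoeff (g : TangentMetric q N) (y₀ : N) {z : Coord q}
    (hz : z ∈ (extChartAt (𝓡 q) y₀).target) (a b c : Fin q) :
    partialDeriv a (fun w => metricCoeff g y₀ w b c) z
      = ∑ d, christoffel g y₀ a b d z * metricCoeff g y₀ z d c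
        + ∑ d, christoffel g y₀ a c d z * metricCoeff g y₀ z b d := by
  have h : ∀ b c, (fun w => metricCoeff g y₀ w b c) = fun w => metricCoeff g y₀ w c b :=
    fun b c => funext fun w => metricCoeff_symm g y₀ w b c
  simp only [metricCoeff_symm g y₀ z b]
  rw [sum_christoffel_mul_metricCoeff g y₀ hz, sum_christoffel_mul_metricCoeff g y₀ hz, h c b]
  ring

lemma curvCoeff_eq_connCurv (g : TangentMetric q N) (y₀ : N) :
    curvCoeff g y₀ = connCurv (christoffel g y₀) :=
  rfl

/-- The metric is a parallel 2-tensor, so the curvature annihilates it; this is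
`sum_connCurv_mul_eq_zero` with `u = id`. -/
lemma riemann_antisymm_right (g : TangentMetric q N) (y₀ : N) {z : Coord q}
    (hz : z ∈ (extChartAt (𝓡 q) y₀).target) (a b c d : Fin q) :
    riemann g y₀ a b c d z = - riemann g y₀ a b d c z := by
  have hg := contDiffAt_metricCoeff g y₀ hz
  have h := sum_connCurv_mul_eq_zero (p := 2) (Γ := christoffel g y₀) (u := id)
    (t := fun c w => metricCoeff g y₀ w (c 0) (c 1)) (z := z)
    (fun a b d => (contDiffAt_christoffel g y₀ hz a b d).differentiableAt (by simp))
    contDiffAt_id (fun c => (hg _ _).of_le (by norm_cast))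
    (by rw [fderiv_id]; exact Function.surjective_id) (by
      filter_upwards [(isOpen_extChartAt_target y₀).mem_nhds hz] with y hy c v
      rw [fderiv_eq_sum_partialDeriv, fderiv_id, Finset.sum_comm]
      refine Finset.sum_congr rfl fun a _ => ?_
      simp [partialDeriv_metricCoeff g y₀ hy, Fin.sum_univ_two, mul_add, Finset.mul_sum,
        mul_assoc]) a b ![d, c]
  simp only [Fin.sum_univ_two, id, Matrix.cons_val_zero, Matrix.cons_val_one,
    Function.update_self, ← curvCoeff_eq_connCurv] at h
  simp only [riemann]
  have h0 : (0 : Fin 2) ≠ 1 := by decide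
  simp only [Function.update_of_ne h0, Function.update_of_ne h0.symm, Matrix.cons_val_zero,
    Matrix.cons_val_one] at h
  simp only [metricCoeff_symm g y₀ z d] at h
  linarith

lemma riemann_antisymm_left (g : TangentMetric q N) (y₀ : N) (a b c d : Fin q) (z : Coord q) :
    riemann g y₀ a b c d z = - riemann g y₀ b a c d z := by
  simp only [riemann, ← Finset.sum_neg_distrib]
  refine Finset.sum_congr rfl fun e _ => ?_
  simp only [curvCoeff, Finset.sum_sub_distrib]
  ring

/-- First Bianchi identity: the connection is torsion-free, so the cyclic sum cancels in pairs. -/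
lemma curvCoeff_bianchi (g : TangentMetric q N) (y₀ : N) (a b c d : Fin q) (z : Coord q) :
    curvCoeff g y₀ a b c d z + curvCoeff g y₀ b c a d z + curvCoeff g y₀ c a b d z = 0 := by
  simp only [curvCoeff, Finset.sum_sub_distrib]
  rw [christoffel_symm g y₀ c b d, christoffel_symm g y₀ c a d, christoffel_symm g y₀ b a d]
  simp only [christoffel_symm g y₀ c b, christoffel_symm g y₀ c a, christoffel_symm g y₀ b a]
  ring

/-- The cycle runs through `a`, `b`, `d`: the vector acted upon sits in the fourth place, and the
third is the lowered index. -/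
lemma riemann_bianchi (g : TangentMetric q N) (y₀ : N) (a b c d : Fin q) (z : Coord q) :
    riemann g y₀ a b c d z + riemann g y₀ b d c a z + riemann g y₀ d a c b z = 0 := by
  simp only [riemann, ← Finset.sum_add_distrib, ← add_mul, curvCoeff_bianchi]
  simp

/-- The classical octahedron argument: a combination of four Bianchi identities, reduced by the two
antisymmetries. -/
lemma riemann_pair_symm (g : TangentMetric q N) (y₀ : N) {z : Coord q}
    (hz : z ∈ (extChartAt (𝓡 q) y₀).target) (a b c d : Fin q) :
    riemann g y₀ a b c d z = riemann g y₀ c d a b z := by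
  have R := riemann_antisymm_right g y₀ hz
  have L := fun a b c d => riemann_antisymm_left g y₀ a b c d z
  have B := fun a b c d => riemann_bianchi g y₀ a b c d z
  linarith [B a b c d, B b c d a, B c d a b, B d a b c, R a b c d, R b d c a, R d a c b,
    R b c d a, R c a d b, R a b d c, R c d a b, R d b a c, R b c a d, R d a b c, R a c b d,
    R c d b a, L a b c d, L b d c a, L d a c b, L c a d b, L a b d c, L c d a b, L d b a c,
    L b c a d, L a c b d, L c d b a, L a c d b, L b d a c, L b c d a, L d a b c, L a d b c,
    L a d c b]

lemma sum_riemann_mul_metricInv (g : TangentMetric q N) (y₀ : N) {z : Coord q}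
    (hz : z ∈ (extChartAt (𝓡 q) y₀).target) (a b c d : Fin q) :
    ∑ x, riemann g y₀ a b x c z * metricInv g y₀ z x d = curvCoeff g y₀ a b c d z := by
  simp only [riemann]
  exact sum_sum_metricCoeff_mul_metricInv g y₀ hz (fun e => curvCoeff g y₀ a b c e z) d

/-- Both sides are double contractions of `riemann`; exchanging the indices within each of its two
pairs matches them, and the two signs cancel. -/
lemma sum_ricci_mul_metricInv (g : TangentMetric q N) (y₀ : N) {z : Coord q}
    (hz : z ∈ (extChartAt (𝓡 q) y₀).target) (a b : Fin q) :
    ∑ A, ricci g y₀ a A z * metricInv g y₀ z A b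
      = ∑ A, ∑ B, curvCoeff g y₀ a A B b z * metricInv g y₀ z A B := by
  simp only [ricci, ← sum_riemann_mul_metricInv g y₀ hz, Finset.sum_mul]
  rw [Finset.sum_comm]
  refine Finset.sum_congr rfl fun A _ => ?_
  rw [Finset.sum_comm]
  refine Finset.sum_congr rfl fun B _ => Finset.sum_congr rfl fun D _ => ?_
  rw [riemann_antisymm_left, riemann_antisymm_right g y₀ hz, metricInv_symm g y₀ z A B]
  ring

end LeviCivita

/-! ### Transverse coordinates and smoothness of the horizontal frame -/

namespace Foliation

variable {m q : ℕ} {M N ι : Type*}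
  [TopologicalSpace M] [ChartedSpace (Coord m) M]
  [TopologicalSpace N] [ChartedSpace (Coord q) N] {F : Foliation m q M N ι} {i : ι} {y₀ : N} {x : M}

lemma mdifferentiableAt_f (hx : x ∈ F.U i) : MDifferentiableAt (𝓡 m) (𝓡 q) (F.f i) x :=
  ((F.contMDiffOn_f i).contMDiffAt ((F.isOpen_U i).mem_nhds hx)).mdifferentiableAt (by simp)

lemma isOpen_coordDomain (F : Foliation m q M N ι) (i : ι) (y₀ : N) :
    IsOpen (F.coordDomain i y₀) :=
  (F.contMDiffOn_f i).continuousOn.isOpen_inter_preimage (F.isOpen_U i)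
    (isOpen_extChartAt_source y₀)

lemma coord_mem_target (hx : x ∈ F.coordDomain i y₀) :
    F.coord i y₀ x ∈ (extChartAt (𝓡 q) y₀).target :=
  (extChartAt (𝓡 q) y₀).map_source hx.2

lemma mfderiv_f_eq (F : Foliation m q M N ι) {i j : ι} (hi : x ∈ F.U i) (hj : x ∈ F.U j)
    (v : TangentSpace (𝓡 m) x) :
    mfderiv (𝓡 m) (𝓡 q) (F.f i) x v
      = mfderiv (𝓡 q) (𝓡 q) (F.γ i j) (F.f j x) (mfderiv (𝓡 m) (𝓡 q) (F.f j) x v) := by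
  have hs := F.mem_source i j x ⟨hi, hj⟩
  have h1 : F.f i =ᶠ[𝓝 x] F.γ i j ∘ F.f j := by
    filter_upwards [((F.isOpen_U i).inter (F.isOpen_U j)).mem_nhds ⟨hi, hj⟩] with y hy
    exact F.f_eq i j y hy
  have h2 : MDifferentiableAt (𝓡 q) (𝓡 q) (F.γ i j) (F.f j x) :=
    ((F.contMDiffOn_γ i j).contMDiffAt ((F.γ i j).open_source.mem_nhds hs)).mdifferentiableAt
      (by simp)
  rw [h1.mfderiv_eq, mfderiv_comp x h2 (mdifferentiableAt_f hj)]
  rfl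

/-- One kernel suffices: by the cocycle relation every other `df_j` factors through `df_i`. -/
lemma leafTangent_eq (F : Foliation m q M N ι) (hx : x ∈ F.U i) :
    F.leafTangent x = LinearMap.ker (mfderiv (𝓡 m) (𝓡 q) (F.f i) x).toLinearMap := by
  refine le_antisymm (F.leafTangent_le hx) (le_iInf₂ fun j hj v hv => ?_)
  have hv' : mfderiv (𝓡 m) (𝓡 q) (F.f i) x v = 0 := hv
  have := F.mfderiv_f_eq hj hx v
  rw [hv', map_zero] at this
  exact this

variable [IsManifold (𝓡 q) ∞ N]

lemma contMDiffAt_coord (hx : x ∈ F.coordDomain i y₀) :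
    ContMDiffAt (𝓡 m) 𝓘(ℝ, Coord q) ∞ (F.coord i y₀) x := by
  refine ContMDiffAt.comp (I' := 𝓡 q) x (contMDiffAt_extChartAt' ?_)
    ((F.contMDiffOn_f i).contMDiffAt ((F.isOpen_U i).mem_nhds hx.1))
  rw [← extChartAt_source (𝓡 q)]
  exact hx.2

lemma mdifferentiableAt_coord (hx : x ∈ F.coordDomain i y₀) :
    MDifferentiableAt (𝓡 m) 𝓘(ℝ, Coord q) (F.coord i y₀) x :=
  (contMDiffAt_coord hx).mdifferentiableAt (by simp)

lemma mfderiv_coord (hx : x ∈ F.coordDomain i y₀) (v : TangentSpace (𝓡 m) x) :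
    mfderiv (𝓡 m) 𝓘(ℝ, Coord q) (F.coord i y₀) x v
      = chartDeriv y₀ (F.f i x) (mfderiv (𝓡 m) (𝓡 q) (F.f i) x v) := by
  have : IsManifold (𝓡 q) 1 N := IsManifold.of_le (n := ∞) (by norm_num)
  have h : MDifferentiableAt (𝓡 q) 𝓘(ℝ, Coord q) (extChartAt (𝓡 q) y₀) (F.f i x) := by
    refine mdifferentiableAt_extChartAt ?_
    rw [← extChartAt_source (𝓡 q)]
    exact hx.2
  have := mfderiv_comp x h (mdifferentiableAt_f hx.1)
  exact DFunLike.congr_fun this v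

lemma surjective_mfderiv_coord (hx : x ∈ F.coordDomain i y₀) :
    Function.Surjective (mfderiv (𝓡 m) 𝓘(ℝ, Coord q) (F.coord i y₀) x) := by
  intro w
  obtain ⟨v, hv⟩ := F.submersion i x hx.1 (chartDerivSymm y₀ (F.f i x) w)
  refine ⟨v, ?_⟩
  rw [mfderiv_coord hx, hv]
  exact chartDeriv_chartDerivSymm hx.2 w

lemma mem_leafTangent_iff (hx : x ∈ F.coordDomain i y₀) (v : TangentSpace (𝓡 m) x) :
    v ∈ F.leafTangent x ↔ mfderiv (𝓡 m) 𝓘(ℝ, Coord q) (F.coord i y₀) x v = 0 := by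
  rw [F.leafTangent_eq hx.1, mfderiv_coord hx]
  refine ⟨fun h => ?_, fun h => ?_⟩
  · have h' : mfderiv (𝓡 m) (𝓡 q) (F.f i) x v = 0 := h
    rw [h', map_zero]
    rfl
  · have := chartDerivSymm_chartDeriv hx.2 (mfderiv (𝓡 m) (𝓡 q) (F.f i) x v)
    rw [h] at this
    exact this.symm.trans (map_zero (chartDerivSymm y₀ (F.f i x)))

variable [IsManifold (𝓡 m) ∞ M] {g : TangentMetric m M}

/-- The differential of the transverse coordinates, read in the chart of `M` at `x₀`. -/
def coordDerivChart (F : Foliation m q M N ι) (i : ι) (y₀ : N) (x₀ x : M) :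
    Coord m →L[ℝ] Coord q :=
  fderiv ℝ (F.coord i y₀ ∘ (extChartAt (𝓡 m) x₀).symm) (extChartAt (𝓡 m) x₀ x)

lemma coordDerivChart_apply {x₀ : M} (hx : x ∈ F.coordDomain i y₀)
    (hx' : x ∈ (extChartAt (𝓡 m) x₀).source) (v : Coord m) :
    F.coordDerivChart i y₀ x₀ x v
      = mfderiv (𝓡 m) 𝓘(ℝ, Coord q) (F.coord i y₀) x (chartDerivSymm x₀ x v) :=
  (mfderiv_eq_fderiv_comp_extChartAt_symm hx' (mdifferentiableAt_coord hx) v).symm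

lemma surjective_coordDerivChart {x₀ : M} (hx : x ∈ F.coordDomain i y₀)
    (hx' : x ∈ (extChartAt (𝓡 m) x₀).source) :
    Function.Surjective (F.coordDerivChart i y₀ x₀ x) := by
  intro w
  obtain ⟨v, hv⟩ := surjective_mfderiv_coord hx w
  refine ⟨chartDeriv x₀ x v, ?_⟩
  rw [coordDerivChart_apply hx hx', chartDerivSymm_chartDeriv hx']
  exact hv

lemma exists_horizontal_lift (g : TangentMetric m M) {x₀ : M} (hx : x ∈ F.coordDomain i y₀)
    (hx' : x ∈ (extChartAt (𝓡 m) x₀).source) (w : Coord q) :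
    (∀ u ∈ F.leafTangent x, g.inner x (chartDerivSymm x₀ x
        (saddleSol (chartMetric g x₀ x) (F.coordDerivChart i y₀ x₀ x) w)) u = 0) ∧
      mfderiv (𝓡 m) 𝓘(ℝ, Coord q) (F.coord i y₀) x (chartDerivSymm x₀ x
        (saddleSol (chartMetric g x₀ x) (F.coordDerivChart i y₀ x₀ x) w)) = w := by
  obtain ⟨h1, h2⟩ := saddleSol_spec (G := chartMetric g x₀ x)
    (fun v hv => chartMetric_pos g hx' hv) (surjective_coordDerivChart hx hx') w
  refine ⟨fun u hu => ?_, ?_⟩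
  · rw [mem_leafTangent_iff hx] at hu
    rw [← chartDerivSymm_chartDeriv hx' u, ← chartMetric_apply]
    refine h2 _ ?_
    rw [coordDerivChart_apply hx hx', chartDerivSymm_chartDeriv hx', hu]
    rfl
  · rw [← coordDerivChart_apply hx hx', h1]

lemma horizFrame_spec (g : TangentMetric m M) (hx : x ∈ F.coordDomain i y₀) (a : Fin q) :
    (∀ u ∈ F.leafTangent x, g.inner x (F.horizFrame g i y₀ a x) u = 0) ∧
      mfderiv (𝓡 m) 𝓘(ℝ, Coord q) (F.coord i y₀) x (F.horizFrame g i y₀ a x)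
        = EuclideanSpace.single a (1 : ℝ) :=
  Classical.epsilon_spec (p := fun v : TangentSpace (𝓡 m) x =>
    (∀ u ∈ F.leafTangent x, g.inner x v u = 0) ∧
      mfderiv (𝓡 m) 𝓘(ℝ, Coord q) (F.coord i y₀) x v = EuclideanSpace.single a (1 : ℝ))
    ⟨_, exists_horizontal_lift g hx (mem_extChartAt_source x) _⟩

lemma coordDeriv_horizFrame (hx : x ∈ F.coordDomain i y₀) (a b : Fin q) :
    F.coordDeriv i y₀ b x (F.horizFrame g i y₀ a x) = if b = a then 1 else 0 := by
  rw [coordDeriv, (horizFrame_spec g hx a).2]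
  simp

/-- Two horizontal lifts of the same vector differ by a vector both tangent and orthogonal to the
leaf, hence by zero. This identifies the chosen frame with the explicit solution in a fixed chart,
and so makes it smooth. -/
lemma horizFrame_eq (g : TangentMetric m M) {x₀ : M} (hx : x ∈ F.coordDomain i y₀)
    (hx' : x ∈ (extChartAt (𝓡 m) x₀).source) (a : Fin q) :
    F.horizFrame g i y₀ a x = chartDerivSymm x₀ x (saddleSol (chartMetric g x₀ x)
      (F.coordDerivChart i y₀ x₀ x) (EuclideanSpace.single a 1)) := by
  obtain ⟨h1, h2⟩ := horizFrame_spec g hx a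
  obtain ⟨h3, h4⟩ := exists_horizontal_lift g hx hx' (EuclideanSpace.single a 1)
  by_contra hne
  have hpos := g.pos x _ (sub_ne_zero.2 hne)
  have hmem : F.horizFrame g i y₀ a x - chartDerivSymm x₀ x (saddleSol (chartMetric g x₀ x)
      (F.coordDerivChart i y₀ x₀ x) (EuclideanSpace.single a 1)) ∈ F.leafTangent x := by
    rw [mem_leafTangent_iff hx, map_sub, h2, h4]
    exact sub_self (EuclideanSpace.single a (1 : ℝ))
  rw [g.symm, map_sub, g.symm, h1 _ hmem, g.symm, h3 _ hmem, sub_self] at hpos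
  exact lt_irrefl _ hpos

lemma contDiffAt_coordDerivChart {x₀ : M} (hx : x ∈ F.coordDomain i y₀)
    (hx' : x ∈ (extChartAt (𝓡 m) x₀).source) :
    ContDiffAt ℝ ∞ (fderiv ℝ (F.coord i y₀ ∘ (extChartAt (𝓡 m) x₀).symm))
      (extChartAt (𝓡 m) x₀ x) :=
  (contDiffAt_comp_extChartAt_symm hx' (contMDiffAt_coord hx)).fderiv_right (by simp)

/-- The components of the horizontal frame in the chart at `x₀`. -/
def horizFrameChart (F : Foliation m q M N ι) (g : TangentMetric m M) (i : ι) (y₀ : N)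
    (a : Fin q) (x₀ x : M) : Coord m :=
  saddleSol (chartMetric g x₀ x) (F.coordDerivChart i y₀ x₀ x) (EuclideanSpace.single a 1)

lemma contMDiffAt_horizFrameChart (g : TangentMetric m M) {x₀ : M} (hx : x ∈ F.coordDomain i y₀)
    (hx' : x ∈ (extChartAt (𝓡 m) x₀).source) (a : Fin q) :
    ContMDiffAt (𝓡 m) 𝓘(ℝ, Coord m) ∞ (F.horizFrameChart g i y₀ a x₀) x := by
  have hinv := (extChartAt (𝓡 m) x₀).left_inv hx'
  have h := ContDiffAt.saddleSol (contDiffAt_chartMetric g hx')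
    (contDiffAt_coordDerivChart hx hx')
    (by
      simp only [Function.comp_apply, hinv]
      exact fun v hv => chartMetric_pos g hx' hv)
    (surjective_coordDerivChart hx hx') (EuclideanSpace.single a 1)
  refine (contMDiffAt_comp_extChartAt hx' h).congr_of_eventuallyEq ?_
  filter_upwards [(isOpen_extChartAt_source x₀).mem_nhds hx'] with y hy
  simp only [Function.comp_apply, (extChartAt (𝓡 m) x₀).left_inv hy]
  rfl

lemma contMDiffAt_horizFrame (g : TangentMetric m M) (hx : x ∈ F.coordDomain i y₀) (a : Fin q) :
    ContMDiffAt (𝓡 m) (𝓡 m).tangent ∞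
      (fun y => (⟨y, F.horizFrame g i y₀ a y⟩ : TangentBundle (𝓡 m) M)) x := by
  refine (contMDiffAt_chartDerivSymm (mem_extChartAt_source x) (contMDiffAt_horizFrameChart g hx
    (mem_extChartAt_source x) a)).congr_of_eventuallyEq ?_
  filter_upwards [(F.isOpen_coordDomain i y₀).mem_nhds hx,
    extChartAt_source_mem_nhds (I := 𝓡 m) x] with y hy hy'
  rw [horizFrame_eq g hy hy']
  rfl

lemma contMDiffAt_comp {p : ℕ} {T : F.NormalTensor p} (hT : T.IsSmooth)
    (g : TangentMetric m M) (hx : x ∈ F.coordDomain i y₀) (c : Fin p → Fin q) :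
    ContMDiffAt (𝓡 m) 𝓘(ℝ, ℝ) ∞ (F.comp g i y₀ T c) x :=
  (hT (F.coordDomain i y₀) (F.isOpen_coordDomain i y₀)
    (fun j => F.horizFrame g i y₀ (c j))
    (fun _ _ hy => (contMDiffAt_horizFrame g hy _).contMDiffWithinAt)).contMDiffAt
      ((F.isOpen_coordDomain i y₀).mem_nhds hx)

/-- The derivative of a smooth function along the horizontal frame is smooth. -/
lemma contMDiffAt_dirDeriv_horizFrame (g : TangentMetric m M) {u : M → ℝ}
    (hu : ContMDiffOn (𝓡 m) 𝓘(ℝ, ℝ) ∞ u (F.coordDomain i y₀)) (hx : x ∈ F.coordDomain i y₀)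
    (a : Fin q) :
    ContMDiffAt (𝓡 m) 𝓘(ℝ, ℝ) ∞ (fun y => dirDeriv u y (F.horizFrame g i y₀ a y)) x := by
  have hopen := F.isOpen_coordDomain i y₀
  have hx' := mem_extChartAt_source (I := 𝓡 m) x
  have h1 : ContMDiffAt (𝓡 m) 𝓘(ℝ, Coord m →L[ℝ] ℝ) ∞ (fun y =>
      fderiv ℝ (u ∘ (extChartAt (𝓡 m) x).symm) (extChartAt (𝓡 m) x y)) x :=
    contMDiffAt_comp_extChartAt hx' ((contDiffAt_comp_extChartAt_symm hx'
      (hu.contMDiffAt (hopen.mem_nhds hx))).fderiv_right (by simp))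
  refine (h1.clm_apply (contMDiffAt_horizFrameChart g hx hx' a)).congr_of_eventuallyEq ?_
  filter_upwards [hopen.mem_nhds hx, extChartAt_source_mem_nhds (I := 𝓡 m) x] with y hy hy'
  rw [horizFrame_eq g hy hy', dirDeriv, mfderiv_eq_fderiv_comp_extChartAt_symm hy'
    ((hu.contMDiffAt (hopen.mem_nhds hy)).mdifferentiableAt (by simp))]
  rfl

end Foliation

/-! ### Product rule and index bookkeeping for tensor products -/

section DirDeriv

variable {m : ℕ} {M : Type*} [TopologicalSpace M] [ChartedSpace (Coord m) M]

lemma dirDeriv_mul {u w : M → ℝ} {x : M} (hu : MDifferentiableAt (𝓡 m) 𝓘(ℝ, ℝ) u x)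
    (hw : MDifferentiableAt (𝓡 m) 𝓘(ℝ, ℝ) w x) (v : TangentSpace (𝓡 m) x) :
    dirDeriv (fun y => u y * w y) x v = dirDeriv u x v * w x + u x * dirDeriv w x v := by
  have h := (hu.hasMFDerivAt.mul hw.hasMFDerivAt).mfderiv
  have h2 := DFunLike.congr_fun h v
  refine Eq.trans h2 ?_
  change u x * dirDeriv w x v + w x * dirDeriv u x v = _
  ring

lemma dirDeriv_congr {u w : M → ℝ} {x : M} (h : u =ᶠ[𝓝 x] w) (v : TangentSpace (𝓡 m) x) :
    dirDeriv u x v = dirDeriv w x v :=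
  DFunLike.congr_fun h.mfderiv_eq v

end DirDeriv

lemma Fin.update_castAdd_comp {α : Type*} {p r : ℕ} (c : Fin (p + r) → α) (j : Fin p) (d : α) :
    Function.update c (Fin.castAdd r j) d ∘ Fin.castAdd r
      = Function.update (c ∘ Fin.castAdd r) j d :=
  Function.update_comp_eq_of_injective _ (Fin.castAdd_injective p r) _ _

lemma Fin.update_castAdd_comp_natAdd {α : Type*} {p r : ℕ} (c : Fin (p + r) → α) (j : Fin p)
    (d : α) : Function.update c (Fin.castAdd r j) d ∘ Fin.natAdd p = c ∘ Fin.natAdd p := by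
  refine Function.update_comp_eq_of_notMem_range _ _ ?_
  rintro ⟨k, hk⟩
  have := congrArg Fin.val hk
  simp at this
  omega

lemma Fin.update_natAdd_comp {α : Type*} {p r : ℕ} (c : Fin (p + r) → α) (j : Fin r) (d : α) :
    Function.update c (Fin.natAdd p j) d ∘ Fin.natAdd p
      = Function.update (c ∘ Fin.natAdd p) j d :=
  Function.update_comp_eq_of_injective _ (Fin.natAdd_injective r p) _ _

lemma Fin.update_natAdd_comp_castAdd {α : Type*} {p r : ℕ} (c : Fin (p + r) → α) (j : Fin r)
    (d : α) : Function.update c (Fin.natAdd p j) d ∘ Fin.castAdd r = c ∘ Fin.castAdd r := by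
  refine Function.update_comp_eq_of_notMem_range _ _ ?_
  rintro ⟨k, hk⟩
  have := congrArg Fin.val hk
  simp at this
  omega

/-! ### Covariant derivatives of `T ⊗ U` for parallel `T` -/

namespace Foliation

variable {m q : ℕ} {M N ι : Type*}
  [TopologicalSpace M] [ChartedSpace (Coord m) M]
  [TopologicalSpace N] [ChartedSpace (Coord q) N] {F : Foliation m q M N ι} {i : ι} {y₀ : N} {x : M}

lemma NormalTensor.tensor_apply {p r : ℕ} (T : F.NormalTensor p) (U : F.NormalTensor r) (x : M)
    (w : Fin (p + r) → F.Normal x) :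
    T.tensor U x w = T x (w ∘ Fin.castAdd r) * U x (w ∘ Fin.natAdd p) := by
  simp only [tensor, MultilinearMap.domDomCongr_apply, LinearMap.compMultilinearMap_apply,
    MultilinearMap.domCoprod_apply, LinearMap.mul'_apply, finSumFinEquiv_apply_left,
    finSumFinEquiv_apply_right]
  rfl

variable [IsManifold (𝓡 m) ∞ M] {g : TangentMetric m M}

lemma comp_tensor {p r : ℕ} (T : F.NormalTensor p) (U : F.NormalTensor r) (c : Fin (p + r) → Fin q)
    (x : M) : F.comp g i y₀ (T.tensor U) c x
      = F.comp g i y₀ T (c ∘ Fin.castAdd r) x * F.comp g i y₀ U (c ∘ Fin.natAdd p) x :=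
  NormalTensor.tensor_apply _ _ _ _

variable [IsManifold (𝓡 q) ∞ N] {g₀ : TangentMetric q N}

lemma mdifferentiableAt_comp {p : ℕ} {T : F.NormalTensor p} (hT : T.IsSmooth)
    (g : TangentMetric m M) (hx : x ∈ F.coordDomain i y₀) (c : Fin p → Fin q) :
    MDifferentiableAt (𝓡 m) 𝓘(ℝ, ℝ) (F.comp g i y₀ T c) x :=
  (contMDiffAt_comp hT g hx c).mdifferentiableAt (by simp)

lemma covDeriv_tensor {p r : ℕ} {T : F.NormalTensor p} (hT : T.IsSmooth) {U : F.NormalTensor r}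
    (hU : U.IsSmooth) (hx : x ∈ F.coordDomain i y₀) (c : Fin (p + r) → Fin q)
    (v : TangentSpace (𝓡 m) x) :
    F.covDeriv g g₀ i y₀ (T.tensor U) c x v
      = F.covDeriv g g₀ i y₀ T (c ∘ Fin.castAdd r) x v * F.comp g i y₀ U (c ∘ Fin.natAdd p) x
        + F.comp g i y₀ T (c ∘ Fin.castAdd r) x
          * F.covDeriv g g₀ i y₀ U (c ∘ Fin.natAdd p) x v := by
  simp only [covDeriv]
  rw [show F.comp g i y₀ (T.tensor U) c = fun y => F.comp g i y₀ T (c ∘ Fin.castAdd r) y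
      * F.comp g i y₀ U (c ∘ Fin.natAdd p) y from funext fun y => comp_tensor T U c y,
    dirDeriv_mul (mdifferentiableAt_comp hT g hx _) (mdifferentiableAt_comp hU g hx _),
    Fin.sum_univ_add]
  simp only [comp_tensor, Fin.update_castAdd_comp, Fin.update_castAdd_comp_natAdd,
    Fin.update_natAdd_comp, Fin.update_natAdd_comp_castAdd, sub_mul, mul_sub, Finset.sum_mul,
    Finset.mul_sum, Function.comp_apply]
  simp only [mul_assoc, mul_left_comm (F.comp g i y₀ T _ x)]
  ring

lemma covDeriv_tensor_of_isParallel {p r : ℕ} {T : F.NormalTensor p} (hT : T.IsSmooth)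
    (hpar : F.IsParallel g g₀ T) {U : F.NormalTensor r}
    (hU : U.IsSmooth) (hx : x ∈ F.coordDomain i y₀) (c : Fin (p + r) → Fin q)
    (v : TangentSpace (𝓡 m) x) :
    F.covDeriv g g₀ i y₀ (T.tensor U) c x v = F.comp g i y₀ T (c ∘ Fin.castAdd r) x
          * F.covDeriv g g₀ i y₀ U (c ∘ Fin.natAdd p) x v := by
  rw [covDeriv_tensor hT hU hx, hpar i y₀ x hx, zero_mul, zero_add]

lemma mdifferentiableAt_covDeriv_horizFrame {p : ℕ} {U : F.NormalTensor p} (hU : U.IsSmooth)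
    (hx : x ∈ F.coordDomain i y₀) (c : Fin p → Fin q) (b : Fin q) :
    MDifferentiableAt (𝓡 m) 𝓘(ℝ, ℝ)
      (fun y => F.covDeriv g g₀ i y₀ U c y (F.horizFrame g i y₀ b y)) x := by
  have hΓ : ∀ a d k, ContMDiffAt (𝓡 m) 𝓘(ℝ, ℝ) ∞
      (fun y => christoffel g₀ y₀ a d k (F.coord i y₀ y)) x := fun a d k =>
    (contDiffAt_christoffel g₀ y₀ (coord_mem_target hx) a d k).contMDiffAt.comp x
      (contMDiffAt_coord hx)
  have h : ContMDiffAt (𝓡 m) 𝓘(ℝ, ℝ) ∞ (fun y =>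
      dirDeriv (F.comp g i y₀ U c) y (F.horizFrame g i y₀ b y)
        - ∑ j, ∑ d, christoffel g₀ y₀ b (c j) d (F.coord i y₀ y)
          * F.comp g i y₀ U (Function.update c j d) y) x := by
    refine (contMDiffAt_dirDeriv_horizFrame g
      (fun y hy => (contMDiffAt_comp hU g hy c).contMDiffWithinAt) hx b).sub ?_
    exact ContMDiffAt.sum fun j _ => ContMDiffAt.sum fun d _ =>
      (hΓ _ _ _).mul (contMDiffAt_comp hU g hx _)
  -- Along `e_b` the transverse components of the direction are constant, so only `Γ_b` enters the
  -- connection term.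
  refine (h.mdifferentiableAt (by simp)).congr_of_eventuallyEq ?_
  filter_upwards [(F.isOpen_coordDomain i y₀).mem_nhds hx] with y hy
  simp only [covDeriv, coordDeriv_horizFrame hy]
  simp

lemma dirDeriv_comp_of_isParallel {p : ℕ} {T : F.NormalTensor p} (hpar : F.IsParallel g g₀ T)
    (hx : x ∈ F.coordDomain i y₀) (c : Fin p → Fin q) (v : TangentSpace (𝓡 m) x) :
    dirDeriv (F.comp g i y₀ T c) x v = ∑ j, ∑ a, ∑ d, F.coordDeriv i y₀ a x v
        * christoffel g₀ y₀ a (c j) d (F.coord i y₀ x)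
        * F.comp g i y₀ T (Function.update c j d) x :=
  sub_eq_zero.1 (hpar i y₀ x hx v c)

/-- The components of `T` need not be constant: their derivatives are Christoffel terms, which
cancel the connection terms in the slots of `T`. -/
lemma covDeriv₂_tensor_of_isParallel {p r : ℕ} {T : F.NormalTensor p} (hT : T.IsSmooth)
    (hpar : F.IsParallel g g₀ T) {U : F.NormalTensor r}
    (hU : U.IsSmooth) (hx : x ∈ F.coordDomain i y₀) (a b : Fin q) (c : Fin (p + r) → Fin q) :
    F.covDeriv₂ g g₀ i y₀ (T.tensor U) a b c x = F.comp g i y₀ T (c ∘ Fin.castAdd r) x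
          * F.covDeriv₂ g g₀ i y₀ U a b (c ∘ Fin.natAdd p) x := by
  have h1 : (fun z => F.covDeriv g g₀ i y₀ (T.tensor U) c z (F.horizFrame g i y₀ b z)) =ᶠ[𝓝 x]
      fun z => F.comp g i y₀ T (c ∘ Fin.castAdd r) z
        * F.covDeriv g g₀ i y₀ U (c ∘ Fin.natAdd p) z (F.horizFrame g i y₀ b z) := by
    filter_upwards [(F.isOpen_coordDomain i y₀).mem_nhds hx] with y hy
    exact covDeriv_tensor_of_isParallel hT hpar hU hy c _
  simp only [covDeriv₂]
  rw [dirDeriv_congr h1, dirDeriv_mul (mdifferentiableAt_comp hT g hx _)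
    (mdifferentiableAt_covDeriv_horizFrame hU hx _ _), dirDeriv_comp_of_isParallel hpar hx,
    Fin.sum_univ_add]
  simp only [coordDeriv_horizFrame hx, ite_mul, one_mul, zero_mul, Finset.sum_ite_eq',
    Finset.mem_univ, if_true, Finset.sum_const_zero, Finset.sum_ite_irrel,
    covDeriv_tensor_of_isParallel hT hpar hU hx, Fin.update_castAdd_comp,
    Fin.update_castAdd_comp_natAdd, Fin.update_natAdd_comp, Fin.update_natAdd_comp_castAdd,
    mul_sub, Finset.sum_mul, Finset.mul_sum, Function.comp_apply]
  simp only [mul_assoc, mul_left_comm (F.comp g i y₀ T _ x)]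
  ring

/-- The curvature annihilates a parallel normal tensor field. -/
lemma sum_curvCoeff_mul_comp_eq_zero {p : ℕ} {T : F.NormalTensor p} (hT : T.IsSmooth)
    (hpar : F.IsParallel g g₀ T) (hx : x ∈ F.coordDomain i y₀) (a b : Fin q) (c : Fin p → Fin q) :
    ∑ j, ∑ d, curvCoeff g₀ y₀ a b (c j) d (F.coord i y₀ x)
      * F.comp g i y₀ T (Function.update c j d) x = 0 := by
  have hs := mem_extChartAt_source (I := 𝓡 m) x
  have hinv := (extChartAt (𝓡 m) x).left_inv hs
  -- The identity is used in a chart of `M`, with the transverse coordinates as the submersion `u`;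
  -- `T` need not be pushed down to `N`.
  have h := sum_connCurv_mul_eq_zero (Γ := christoffel g₀ y₀)
    (u := F.coord i y₀ ∘ (extChartAt (𝓡 m) x).symm)
    (t := fun c => F.comp g i y₀ T c ∘ (extChartAt (𝓡 m) x).symm) (z := extChartAt (𝓡 m) x x)
    (fun a b d => by
      rw [Function.comp_apply, hinv]
      exact (contDiffAt_christoffel g₀ y₀ (coord_mem_target hx) a b d).differentiableAt (by simp))
    ((contDiffAt_comp_extChartAt_symm hs (contMDiffAt_coord hx)).of_le (by norm_cast))
    (fun c => (contDiffAt_comp_extChartAt_symm hs (contMDiffAt_comp hT g hx c)).of_le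
      (by norm_cast))
    (surjective_coordDerivChart hx hs) ?_ a b c
  · simpa only [Function.comp_apply, hinv, ← curvCoeff_eq_connCurv] using h
  · have hmem : (extChartAt (𝓡 m) x).symm ⁻¹' F.coordDomain i y₀ ∈ 𝓝 (extChartAt (𝓡 m) x x) :=
      (continuousAt_extChartAt_symm x).preimage_mem_nhds
        ((F.isOpen_coordDomain i y₀).mem_nhds (by rwa [hinv]))
    filter_upwards [hmem, extChartAt_target_mem_nhds (I := 𝓡 m) x] with y hy hy' c v
    have hy'' := (extChartAt (𝓡 m) x).map_target hy'
    have h1 := mfderiv_eq_fderiv_comp_extChartAt_symm hy'' (mdifferentiableAt_comp hT g hy c) v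
    have h2 := mfderiv_eq_fderiv_comp_extChartAt_symm hy'' (mdifferentiableAt_coord hy) v
    rw [(extChartAt (𝓡 m) x).right_inv hy'] at h1 h2
    rw [← h1, ← h2]
    exact dirDeriv_comp_of_isParallel hpar hy c _

end Foliation

/-- Four blocks of ordered pairs; in the two mixed blocks the indices are automatically distinct. -/
lemma Fin.sum_sum_erase_add {p r : ℕ} (f : Fin (p + r) → Fin (p + r) → ℝ) :
    ∑ j, ∑ k ∈ Finset.univ.erase j, f j k
      = ∑ j : Fin p, ∑ k ∈ Finset.univ.erase j, f (Fin.castAdd r j) (Fin.castAdd r k)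
        + ∑ j : Fin p, ∑ k : Fin r, f (Fin.castAdd r j) (Fin.natAdd p k)
        + ∑ j : Fin r, ∑ k : Fin p, f (Fin.natAdd p j) (Fin.castAdd r k)
        + ∑ j : Fin r, ∑ k ∈ Finset.univ.erase j, f (Fin.natAdd p j) (Fin.natAdd p k) := by
  simp only [Finset.sum_erase_eq_sub (Finset.mem_univ _), Finset.sum_sub_distrib,
    Fin.sum_univ_add, Finset.sum_add_distrib]
  ring

lemma Fintype.sum_sum_sum_comm_sum_sum {α β γ δ κ : Type*} [Fintype α] [Fintype β] [Fintype γ]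
    [Fintype δ] [Fintype κ] (f : α → β → γ → δ → κ → ℝ) :
    ∑ a, ∑ b, ∑ c, ∑ d, ∑ e, f a b c d e = ∑ d, ∑ e, ∑ a, ∑ b, ∑ c, f a b c d e := by
  simpa only [Fintype.sum_prod_type] using Finset.sum_comm (s := Finset.univ) (t := Finset.univ)
    (f := fun (x : α × β × γ) (y : δ × κ) => f x.1 x.2.1 x.2.2 y.1 y.2)

/-! ### Curvature terms of a tensor annihilated by the curvature -/

section Weitzenboeck

variable {q : ℕ} {N : Type*} [TopologicalSpace N] [ChartedSpace (Coord q) N]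
  [IsManifold (𝓡 q) ∞ N] {g : TangentMetric q N} {y₀ : N} {z : Coord q} {p : ℕ}
  {t : (Fin p → Fin q) → ℝ}

/-- This is `ht` with an index lowered and raised again; the antisymmetry in the last pair costs a
global sign. -/
lemma sum_riemann_right_mul_eq_zero (hz : z ∈ (extChartAt (𝓡 q) y₀).target)
    (ht : ∀ a b c, ∑ j, ∑ d, curvCoeff g y₀ a b (c j) d z * t (Function.update c j d) = 0)
    (a A : Fin q) (c : Fin p → Fin q) :
    ∑ k, ∑ B, ∑ B', riemann g y₀ a A (c k) B z * metricInv g y₀ z B B'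
      * t (Function.update c k B') = 0 := by
  rw [← neg_eq_zero, ← ht a A c, ← Finset.sum_neg_distrib]
  refine Finset.sum_congr rfl fun k _ => ?_
  rw [Finset.sum_comm, ← Finset.sum_neg_distrib]
  refine Finset.sum_congr rfl fun d _ => ?_
  rw [← sum_riemann_mul_metricInv g y₀ hz, ← Finset.sum_mul, ← neg_mul,
    ← Finset.sum_neg_distrib]
  congr 1
  refine Finset.sum_congr rfl fun e _ => ?_
  rw [riemann_antisymm_right g y₀ hz]
  ring

lemma sum_riemann_left_mul_eq_zero (hz : z ∈ (extChartAt (𝓡 q) y₀).target)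
    (ht : ∀ a b c, ∑ j, ∑ d, curvCoeff g y₀ a b (c j) d z * t (Function.update c j d) = 0)
    (b B : Fin q) (c : Fin p → Fin q) :
    ∑ j, ∑ A, ∑ A', riemann g y₀ (c j) A b B z * metricInv g y₀ z A A'
      * t (Function.update c j A') = 0 := by
  rw [← sum_riemann_right_mul_eq_zero hz ht b B c]
  refine Finset.sum_congr rfl fun k _ => Finset.sum_congr rfl fun A _ =>
    Finset.sum_congr rfl fun A' _ => ?_
  rw [riemann_pair_symm g y₀ hz]

/-- The curvature term of the basic Laplacian vanishes on tensors annihilated by the curvature. -/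
lemma sum_ricci_eq_sum_riemann (hz : z ∈ (extChartAt (𝓡 q) y₀).target)
    (ht : ∀ a b c, ∑ j, ∑ d, curvCoeff g y₀ a b (c j) d z * t (Function.update c j d) = 0)
    (c : Fin p → Fin q) :
    ∑ j, ∑ A, ∑ A', ricci g y₀ (c j) A z * metricInv g y₀ z A A' * t (Function.update c j A')
      = ∑ j, ∑ k ∈ Finset.univ.erase j, ∑ A, ∑ A', ∑ B, ∑ B',
        riemann g y₀ (c j) A (c k) B z * metricInv g y₀ z A A' * metricInv g y₀ z B B'
        * t (Function.update (Function.update c j A') k B') := by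
  refine Finset.sum_congr rfl fun j _ => ?_
  -- Annihilation at the multi-index with `A'` in place `j`: the sum over the other slots is minus
  -- the term at `j`, where the second substitution overwrites `A'`.
  have h : ∀ A A', ∑ k ∈ Finset.univ.erase j, ∑ B, ∑ B',
      riemann g y₀ (c j) A (c k) B z * metricInv g y₀ z B B'
        * t (Function.update (Function.update c j A') k B')
      = ∑ B', curvCoeff g y₀ (c j) A A' B' z * t (Function.update c j B') := by
    intro A A'
    have h1 := sum_riemann_right_mul_eq_zero hz ht (c j) A (Function.update c j A')
    rw [← Finset.add_sum_erase _ _ (Finset.mem_univ j)] at h1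
    simp only [Function.update_self, Function.update_idem] at h1
    have h2 : ∑ k ∈ Finset.univ.erase j, ∑ B, ∑ B',
        riemann g y₀ (c j) A (Function.update c j A' k) B z * metricInv g y₀ z B B'
          * t (Function.update (Function.update c j A') k B')
        = ∑ k ∈ Finset.univ.erase j, ∑ B, ∑ B',
          riemann g y₀ (c j) A (c k) B z * metricInv g y₀ z B B'
            * t (Function.update (Function.update c j A') k B') :=
      Finset.sum_congr rfl fun k hk => by rw [Function.update_of_ne (Finset.ne_of_mem_erase hk)]
    rw [h2] at h1
    rw [← neg_eq_iff_add_eq_zero.2 h1, Finset.sum_comm, ← Finset.sum_neg_distrib]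
    refine Finset.sum_congr rfl fun B' _ => ?_
    rw [← sum_riemann_mul_metricInv g y₀ hz, Finset.sum_mul, ← Finset.sum_neg_distrib]
    refine Finset.sum_congr rfl fun B _ => ?_
    rw [riemann_antisymm_right g y₀ hz]
    ring
  calc _ = ∑ A', (∑ A, ricci g y₀ (c j) A z * metricInv g y₀ z A A')
        * t (Function.update c j A') := by
        rw [Finset.sum_comm]
        simp only [Finset.sum_mul]
    _ = ∑ A, ∑ A', metricInv g y₀ z A A' * ∑ k ∈ Finset.univ.erase j, ∑ B, ∑ B',
      riemann g y₀ (c j) A (c k) B z * metricInv g y₀ z B B'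
        * t (Function.update (Function.update c j A') k B') := by
        simp only [h, sum_ricci_mul_metricInv g y₀ hz, Finset.sum_mul, Finset.mul_sum]
        rw [Finset.sum_comm]
        refine Finset.sum_congr rfl fun A _ => ?_
        rw [Finset.sum_comm]
        refine Finset.sum_congr rfl fun B _ => Finset.sum_congr rfl fun D _ => by ring
    _ = _ := by
        symm
        rw [Finset.sum_comm]
        refine Finset.sum_congr rfl fun A _ => ?_
        rw [Finset.sum_comm]
        refine Finset.sum_congr rfl fun A' _ => ?_
        simp only [Finset.mul_sum]
        refine Finset.sum_congr rfl fun k _ => Finset.sum_congr rfl fun B _ =>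
          Finset.sum_congr rfl fun B' _ => by ring

end Weitzenboeck

/-! ### The Laplacian of `T ⊗ U`, in components and as a tensor -/

namespace Foliation

variable {m q : ℕ} {M N ι : Type*}
  [TopologicalSpace M] [ChartedSpace (Coord m) M] [IsManifold (𝓡 m) ∞ M]
  [TopologicalSpace N] [ChartedSpace (Coord q) N] [IsManifold (𝓡 q) ∞ N]
  {F : Foliation m q M N ι} {i : ι} {y₀ : N} {x : M} {g : TangentMetric m M}
  {g₀ : TangentMetric q N}

/-- The Ricci terms in the slots of `T` cancel the block with both slots in `T`, the mixed blocks
vanish by annihilation, and the rest is `T` times the Laplacian of `U`. -/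
lemma laplacianComp_tensor_of_isParallel {p r : ℕ} {T : F.NormalTensor p} (hT : T.IsSmooth)
    (hpar : F.IsParallel g g₀ T) {U : F.NormalTensor r}
    (hU : U.IsSmooth) (hx : x ∈ F.coordDomain i y₀) (c : Fin (p + r) → Fin q) :
    F.laplacianComp g g₀ i y₀ (T.tensor U) c x = F.comp g i y₀ T (c ∘ Fin.castAdd r) x
      * F.laplacianComp g g₀ i y₀ U (c ∘ Fin.natAdd p) x := by
  have hz := coord_mem_target hx
  have hcurv := sum_curvCoeff_mul_comp_eq_zero (g := g) (g₀ := g₀) hT hpar hx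
  have hR := sum_ricci_eq_sum_riemann (g := g₀) (t := fun c => F.comp g i y₀ T c x) hz hcurv
    (c ∘ Fin.castAdd r)
  have hcross : ∀ (j : Fin r) (A A' : Fin q), ∑ k : Fin p, ∑ B, ∑ B',
      riemann g₀ y₀ (c (Fin.natAdd p j)) A (c (Fin.castAdd r k)) B (F.coord i y₀ x)
        * metricInv g₀ y₀ (F.coord i y₀ x) B B'
        * F.comp g i y₀ T (Function.update (c ∘ Fin.castAdd r) k B') x = 0 := fun j A A' =>
    sum_riemann_right_mul_eq_zero (t := fun c => F.comp g i y₀ T c x) hz hcurv _ A _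
  have hcross' : ∀ (k : Fin r) (B B' : Fin q), ∑ j : Fin p, ∑ A, ∑ A',
      riemann g₀ y₀ (c (Fin.castAdd r j)) A (c (Fin.natAdd p k)) B (F.coord i y₀ x)
        * metricInv g₀ y₀ (F.coord i y₀ x) A A'
        * F.comp g i y₀ T (Function.update (c ∘ Fin.castAdd r) j A') x = 0 := fun k B B' =>
    sum_riemann_left_mul_eq_zero (t := fun c => F.comp g i y₀ T c x) hz hcurv _ B _
  simp only [laplacianComp]
  rw [Fin.sum_univ_add, Fin.sum_sum_erase_add]
  simp only [covDeriv₂_tensor_of_isParallel hT hpar hU hx, comp_tensor, Fin.update_castAdd_comp,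
    Fin.update_castAdd_comp_natAdd, Fin.update_natAdd_comp, Fin.update_natAdd_comp_castAdd]
  have hpr : ∑ j : Fin p, ∑ k : Fin r, ∑ A, ∑ A', ∑ B, ∑ B',
      riemann g₀ y₀ (c (Fin.castAdd r j)) A (c (Fin.natAdd p k)) B (F.coord i y₀ x)
        * metricInv g₀ y₀ (F.coord i y₀ x) A A' * metricInv g₀ y₀ (F.coord i y₀ x) B B'
        * (F.comp g i y₀ T (Function.update (c ∘ Fin.castAdd r) j A') x
          * F.comp g i y₀ U (Function.update (c ∘ Fin.natAdd p) k B') x) = 0 := by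
    -- The slot of `U` and its two indices are moved outside, so that the inner sum is a curvature
    -- operator acting on `T`.
    rw [Finset.sum_comm]
    refine Finset.sum_eq_zero fun k _ => ?_
    rw [Fintype.sum_sum_sum_comm_sum_sum]
    refine Finset.sum_eq_zero fun B _ => Finset.sum_eq_zero fun B' _ => ?_
    rw [← mul_zero (metricInv g₀ y₀ (F.coord i y₀ x) B B'
      * F.comp g i y₀ U (Function.update (c ∘ Fin.natAdd p) k B') x), ← hcross' k B B']
    simp only [Finset.mul_sum]
    refine Finset.sum_congr rfl fun j _ => Finset.sum_congr rfl fun A _ =>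
      Finset.sum_congr rfl fun A' _ => by ring
  have hrp : ∑ j : Fin r, ∑ k : Fin p, ∑ A, ∑ A', ∑ B, ∑ B',
      riemann g₀ y₀ (c (Fin.natAdd p j)) A (c (Fin.castAdd r k)) B (F.coord i y₀ x)
        * metricInv g₀ y₀ (F.coord i y₀ x) A A' * metricInv g₀ y₀ (F.coord i y₀ x) B B'
        * (F.comp g i y₀ T (Function.update (c ∘ Fin.castAdd r) k B') x
          * F.comp g i y₀ U (Function.update (c ∘ Fin.natAdd p) j A') x) = 0 := by
    refine Finset.sum_eq_zero fun j _ => ?_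
    rw [Finset.sum_comm]
    refine Finset.sum_eq_zero fun A _ => ?_
    rw [Finset.sum_comm]
    refine Finset.sum_eq_zero fun A' _ => ?_
    rw [← mul_zero (metricInv g₀ y₀ (F.coord i y₀ x) A A'
      * F.comp g i y₀ U (Function.update (c ∘ Fin.natAdd p) j A') x), ← hcross j A A']
    simp only [Finset.mul_sum]
    refine Finset.sum_congr rfl fun k _ => Finset.sum_congr rfl fun B _ =>
      Finset.sum_congr rfl fun B' _ => by ring
  rw [hpr, hrp]
  simp only [← mul_assoc, ← Finset.sum_mul, Function.comp_apply] at hR ⊢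
  rw [hR]
  simp only [mul_sub, mul_add, mul_neg, Finset.mul_sum]
  simp only [mul_assoc, mul_left_comm (F.comp g i y₀ T _ x)]
  ring

/-- A normal vector is determined by its components. -/
lemma sum_normalCoord_smul_horizFrame (g : TangentMetric m M) (hx : x ∈ F.coordDomain i y₀)
    (w : F.Normal x) :
    ∑ a, F.normalCoord y₀ hx.1 a w • (F.leafTangent x).mkQ (F.horizFrame g i y₀ a x) = w := by
  obtain ⟨v, rfl⟩ := (F.leafTangent x).mkQ_surjective w
  have h : ∀ a, F.normalCoord y₀ hx.1 a ((F.leafTangent x).mkQ v) = F.coordDeriv i y₀ a x v := by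
    intro a
    rw [coordDeriv, mfderiv_coord hx]
    rfl
  simp only [h, ← map_smul, ← map_sum]
  rw [Submodule.mkQ_apply, Submodule.mkQ_apply, Submodule.Quotient.eq, mem_leafTangent_iff hx,
    map_sub, map_sum]
  simp only [map_smul, (horizFrame_spec g hx _).2]
  refine sub_eq_zero.2 (?_ : (_ : Coord q) = _)
  have h1 := (EuclideanSpace.basisFun (Fin q) ℝ).sum_repr
    (mfderiv (𝓡 m) 𝓘(ℝ, Coord q) (F.coord i y₀) x v : Coord q)
  simp only [EuclideanSpace.basisFun_apply] at h1
  exact h1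

lemma sum_comp_mul_prod_normalCoord {p : ℕ} (T : F.NormalTensor p) (g : TangentMetric m M)
    (hx : x ∈ F.coordDomain i y₀) (w : Fin p → F.Normal x) :
    ∑ c : Fin p → Fin q, F.comp g i y₀ T c x * ∏ j, F.normalCoord y₀ hx.1 (c j) (w j)
      = T x w := by
  conv_rhs => rw [← funext fun j => sum_normalCoord_smul_horizFrame g hx (w j),
    MultilinearMap.map_sum]
  refine Finset.sum_congr rfl fun c _ => ?_
  rw [MultilinearMap.map_smul_univ, smul_eq_mul, mul_comm]
  rfl

lemma laplacianIn_apply {p : ℕ} (T : F.NormalTensor p) (hx : x ∈ F.U i)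
    (w : Fin p → F.Normal x) :
    F.laplacianIn g g₀ y₀ T hx w = ∑ c : Fin p → Fin q, F.laplacianComp g g₀ i y₀ T c x
      * ∏ j, F.normalCoord y₀ hx (c j) (w j) := by
  simp [laplacianIn]

/-- A multi-index of length `p + r` is a pair of multi-indices (`Fin.appendEquiv`), so the
componentwise product formula sums to a product of two full expansions. -/
lemma laplacianIn_tensor_of_isParallel {p r : ℕ} {T : F.NormalTensor p} (hT : T.IsSmooth)
    (hpar : F.IsParallel g g₀ T) {U : F.NormalTensor r}
    (hU : U.IsSmooth) (hx : x ∈ F.coordDomain i y₀) (w : Fin (p + r) → F.Normal x) :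
    F.laplacianIn g g₀ y₀ (T.tensor U) hx.1 w
      = T x (w ∘ Fin.castAdd r) * F.laplacianIn g g₀ y₀ U hx.1 (w ∘ Fin.natAdd p) := by
  rw [laplacianIn_apply, laplacianIn_apply, ← sum_comp_mul_prod_normalCoord T g hx,
    Finset.sum_mul_sum, ← Fintype.sum_prod_type',
    ← (Fin.appendEquiv p r).sum_comp]
  refine Finset.sum_congr rfl fun c _ => ?_
  rw [laplacianComp_tensor_of_isParallel hT hpar hU hx, Fin.prod_univ_add]
  simp [Fin.appendEquiv, Function.comp_def]
  ring

end Foliation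

end

theorem mainTheorem7 {m q : ℕ} {M N ι : Type*}
    [TopologicalSpace M] [ChartedSpace (Coord m) M] [IsManifold (𝓡 m) ∞ M]
    [TopologicalSpace N] [ChartedSpace (Coord q) N] [IsManifold (𝓡 q) ∞ N]
    (g : TangentMetric m M) (g₀ : TangentMetric q N)
    (F : Foliation m q M N ι) (hF : F.IsRiemannian g g₀)
    {p : ℕ} (T : F.NormalTensor p) (hT : T.IsSmooth) (hpar : F.IsParallel g g₀ T)
    {r : ℕ} (U : F.NormalTensor r) (hU : U.IsSmooth) :
    F.basicLaplacian g g₀ (T.tensor U) = T.tensor (F.basicLaplacian g g₀ U) := by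
  funext x
  ext w
  rw [Foliation.NormalTensor.tensor_apply]
  -- The coordinates chosen at `x` depend on `x` alone, so both Laplacians are computed in the same
  -- ones and no independence of coordinates is needed.
  exact Foliation.laplacianIn_tensor_of_isParallel hT hpar hU
    ⟨(F.exists_mem x).choose_spec, mem_extChartAt_source _⟩ w
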